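/- Let $k$ be a field of characteristic $0$, let $S$ be a nonempty finite set, and let $s:S\times S\to S\times S$ be a bijection satisfying the reversed pentagon equation $s_{12}s_{13}s_{23}=s_{23}s_{12}$ on $S\times S\times S$. Write $s(x,y)=(\psi_y(x),\,y\circ x)$. Let $A=\operatorname{End}_k(k[S])$ with matrix units $S_{i,j}$ ($S_{i,j}(j)=i$ and $S_{i,j}(l)=0$ for $l\neq j$), and put $$R=\sum_{x,y\in S}S_{\psi_y(x),x}\otimes S_{y\circ x,y}\in A\otimes A ,$$ which is invertible. Then the following hold. **(The coefficient Hopf algebras.)** The subspace $H_r(s)=\{(a\otimes 1)(R)\mid a\in A^*\}$ is a unital subalgebra of $A$ and a Hopf algebra with $$\varepsilon((a\otimes1)(R))=a(1),\qquad \Delta(h)=R(h\otimes 1)R^{-1},\qquad \mathcal S((a\otimes 1)(R))=(a\otimes 1)(R^{-1}).$$ The subspace $H_\ell(s)=\{(1\otimes a)(R)\mid a\in A^*\}$ is a unital subalgebra of $A$ and a Hopf algebra with $$\varepsilon((1\otimes a)(R))=a(1),\qquad \Delta(h)=R^{-1}(1\otimes h)R,\qquad \mathcal S((1\otimes a)(R))=(1\otimes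 a)(R^{-1}).$$ **(The bases.)** Let $E=\{e\in S\mid e\circ e=e\}$. There is an element $1\in E$ with $\psi_1=\mathrm{id}_S$, and a set $\bar E\subseteq E$ containing $1$ such that for every $e\in E$ there is exactly one $f\in\bar E$ with $\psi_f=\psi_e$. For every such choice of $1$ and $\bar E$, put $G=1\circ S$. Then the families $$\Big(\sum_{y\in S:\ \psi_y=\psi_{y'}}S_{y\circ x',\,y}\Big)_{(y',x')\in\bar E\times G}\qquad\text{and}\qquad \Big(\sum_{x\in\{e\circ x'\mid e\in E\}}S_{\psi_{y'}(x),\,x}\Big)_{(y',x')\in\bar E\times G}$$ are $k$-bases of $H_r(s)$ and of $H_\ell(s)$, respectively. The elements of the first basis belong to the set of all sums $\sum_{y:\ \psi_y(x')=\psi_{y'}(x')}S_{y\circ x',y}$ with $x',y'\in S$, and those of the second to the set of all sums $\sum_{x:\ y'\circ x=y'\circ x'}S_{\psi_{y'}(x),x}$ with $x',y'\in S$. Each of these two bases $\mathcal B$ of $H=H_r(s)$, respectively $H=H_\ell(s)$, has the following properties. 1. All structure constants with respect to $\mathcal B$ (the coordinates of $1_H$; the values $\varepsilon(b)$; the coordinates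 of the products $bb'$; the coordinates of $\Delta(b)$ in the basis $\mathcal B\otimes\mathcal B$; the coordinates of $\mathcal S(b)$; for $b,b'\in\mathcal B$) lie in $\{0,1\}$. 2. In particular, $\mathcal B$ is positive: under every embedding $k\hookrightarrow\mathbb C$, all these structure constants are nonnegative real numbers. 3. $\mathcal B$ is $\Phi$-set theoretic: for $\Phi_H=(\mathrm{id}\otimes m)(\Delta\otimes\mathrm{id})$, where $m$ is the multiplication of $H$, and all $b,c\in\mathcal B$, there are $b',c'\in\mathcal B$ with $\Phi_H(b\otimes c)=b'\otimes c'$. -/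

import Mathlib

open scoped TensorProduct

universe u v w

namespace PentagonHopf

/-! ### Set-theoretic solutions of the reversed pentagon equation -/

section SetTheoretic

variable {S : Type u}

/-- `s₁₂ = s × id`. -/
def leg12 (s : S × S → S × S) : S × S × S → S × S × S :=
  fun p => ((s (p.1, p.2.1)).1, (s (p.1, p.2.1)).2, p.2.2)

/-- `s₁₃`, acting on the first and the third coordinate. -/
def leg13 (s : S × S → S × S) : S × S × S → S × S × S :=
  fun p => ((s (p.1, p.2.2)).1, p.2.1, (s (p.1, p.2.2)).2)

/-- `s₂₃ = id × s`. -/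
def leg23 (s : S × S → S × S) : S × S × S → S × S × S :=
  fun p => (p.1, s p.2)

/-- The reversed pentagon equation `s₁₂ s₁₃ s₂₃ = s₂₃ s₁₂`. -/
def IsRPESolution (s : S × S → S × S) : Prop :=
  leg12 s ∘ leg13 s ∘ leg23 s = leg23 s ∘ leg12 s

/-- The map `ψ_y`, where `s (x, y) = (ψ_y x, y ∘ x)`. -/
def psi (s : S × S → S × S) (y : S) : S → S := fun x => (s (x, y)).1

/-- The operation `y ∘ x`, where `s (x, y) = (ψ_y x, y ∘ x)`. -/
def circ (s : S × S → S × S) (y x : S) : S := (s (x, y)).2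

/-- `e` is an idempotent of `(S, ∘)`. -/
def IsIdem (s : S × S → S × S) (e : S) : Prop := circ s e e = e

/-- The set `1 ∘ S`, which is the group `G` when `1` is an idempotent. -/
def groupPart (s : S × S → S × S) (one : S) : Set S := Set.range (circ s one)

/-- The choices on which the basis depends: an idempotent `1` with `ψ_1 = id`, and a set `Ebar`
of representatives, containing `1`, of the idempotents modulo `e ∼ f ↔ ψ_e = ψ_f`. -/
structure IsTransversal (s : S × S → S × S) (one : S) (Ebar : Set S) : Prop where
  isIdem_one : IsIdem s one
  psi_one : psi s one = id
  one_mem : one ∈ Ebar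
  isIdem_of_mem : ∀ e ∈ Ebar, IsIdem s e
  existsUnique : ∀ e, IsIdem s e → ∃! f, f ∈ Ebar ∧ psi s f = psi s e

end SetTheoretic

/-! ### The algebra solution and its coefficients -/

section Coefficients

variable (k : Type v) [Field k] {S : Type u} [Fintype S] [DecidableEq S]

/-- The element `∑ S_{ψ_y x, x} ⊗ S_{y ∘ x, y}` of `A ⊗ A`, where `A` is the algebra of matrices
indexed by `S` (the endomorphisms of `k[S]`) and `S_{i,j}` is the matrix unit with its entry `1`
in row `i` and column `j`. -/
noncomputable def tensorOf (s : S × S → S × S) : Matrix S S k ⊗[k] Matrix S S k :=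
  ∑ p : S × S, Matrix.single (s p).1 p.1 (1 : k) ⊗ₜ[k] Matrix.single (s p).2 p.2 (1 : k)

theorem tensorOf_mul (s t : S × S → S × S) :
    tensorOf k s * tensorOf k t = tensorOf k (s ∘ t) := by
  unfold tensorOf
  rw [Finset.sum_mul_sum, Finset.sum_comm]
  refine Finset.sum_congr rfl fun q _ => ?_
  rw [Finset.sum_eq_single (t q)]
  · simp
  · intro p _ hp
    rw [Algebra.TensorProduct.tmul_mul_tmul]
    by_cases h1 : p.1 = (t q).1
    · have h2 : p.2 ≠ (t q).2 := fun h2 => hp (Prod.ext h1 h2)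
      rw [Matrix.single_mul_single_of_ne _ _ _ _ h2, TensorProduct.tmul_zero]
    · rw [Matrix.single_mul_single_of_ne _ _ _ _ h1, TensorProduct.zero_tmul]
  · simp

theorem tensorOf_id : tensorOf k (id : S × S → S × S) = 1 := by
  have h : ∑ x : S, Matrix.single x x (1 : k) = 1 := by
    ext i j
    by_cases hij : i = j
    · subst hij
      simp [Matrix.sum_apply, Matrix.single_apply]
    · have h0 : ∀ x : S, ¬ (x = i ∧ x = j) := fun x hx => hij (hx.1.symm.trans hx.2)
      simp [Matrix.sum_apply, hij, h0]
  simp only [tensorOf, Fintype.sum_prod_type, id, ← TensorProduct.tmul_sum,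
    ← TensorProduct.sum_tmul, h, Algebra.TensorProduct.one_def]

/-- The algebra solution `R = s^A` of a bijective solution `s`, as a unit of `A ⊗ A`; its inverse
is `(s⁻¹)^A`. -/
noncomputable def algSolution (s : Equiv.Perm (S × S)) :
    (Matrix S S k ⊗[k] Matrix S S k)ˣ where
  val := tensorOf k s
  inv := tensorOf k s.symm
  val_inv := by rw [tensorOf_mul, Equiv.self_comp_symm, tensorOf_id]
  inv_val := by rw [tensorOf_mul, Equiv.symm_comp_self, tensorOf_id]

variable {k}

/-- `(a ⊗ 1)(T)`: apply the functional `a` to the first leg of `T`. -/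
noncomputable def sliceRight (T : Matrix S S k ⊗[k] Matrix S S k)
    (a : Module.Dual k (Matrix S S k)) : Matrix S S k :=
  TensorProduct.lid k (Matrix S S k) (LinearMap.rTensor (Matrix S S k) a T)

/-- `(1 ⊗ a)(T)`: apply the functional `a` to the second leg of `T`. -/
noncomputable def sliceLeft (T : Matrix S S k ⊗[k] Matrix S S k)
    (a : Module.Dual k (Matrix S S k)) : Matrix S S k :=
  TensorProduct.rid k (Matrix S S k) (LinearMap.lTensor (Matrix S S k) a T)

/-- The Hopf algebra `H`, embedded in `A` by `ι`, is the right coefficient Hopf algebra `H_r(s)`: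
the subspace `R_(r) = {(a ⊗ 1)(R) | a ∈ A^*}` of `A`, with the unit and the multiplication of `A`,
`ε((a ⊗ 1)(R)) = a(1)`, `Δ(x) = R (x ⊗ 1) R⁻¹` and `S((a ⊗ 1)(R)) = (a ⊗ 1)(R⁻¹)`. -/
structure IsRightCoefficientHopfAlgebra (s : Equiv.Perm (S × S)) {H : Type w} [Ring H]
    [HopfAlgebra k H] (ι : H →ₐ[k] Matrix S S k) : Prop where
  injective : Function.Injective ι
  range_eq : Set.range ι = Set.range (sliceRight (algSolution k s).val)
  counit_eq : ∀ (h : H) (a : Module.Dual k (Matrix S S k)),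
    ι h = sliceRight (algSolution k s).val a → Coalgebra.counit (R := k) h = a 1
  comul_eq : ∀ h : H,
    TensorProduct.map ι.toLinearMap ι.toLinearMap (Coalgebra.comul (R := k) h) =
      (algSolution k s).val * (ι h ⊗ₜ[k] 1) * (algSolution k s).inv
  antipode_eq : ∀ (h : H) (a : Module.Dual k (Matrix S S k)),
    ι h = sliceRight (algSolution k s).val a →
      ι (HopfAlgebra.antipode k h) = sliceRight (algSolution k s).inv a

/-- The Hopf algebra `H`, embedded in `A` by `ι`, is the left coefficient Hopf algebra `H_ℓ(s)`:
the subspace `R_(ℓ) = {(1 ⊗ a)(R) | a ∈ A^*}` of `A`, with the unit and the multiplication of `A`,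
`ε((1 ⊗ a)(R)) = a(1)`, `Δ(x) = R⁻¹ (1 ⊗ x) R` and `S((1 ⊗ a)(R)) = (1 ⊗ a)(R⁻¹)`. -/
structure IsLeftCoefficientHopfAlgebra (s : Equiv.Perm (S × S)) {H : Type w} [Ring H]
    [HopfAlgebra k H] (ι : H →ₐ[k] Matrix S S k) : Prop where
  injective : Function.Injective ι
  range_eq : Set.range ι = Set.range (sliceLeft (algSolution k s).val)
  counit_eq : ∀ (h : H) (a : Module.Dual k (Matrix S S k)),
    ι h = sliceLeft (algSolution k s).val a → Coalgebra.counit (R := k) h = a 1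
  comul_eq : ∀ h : H,
    TensorProduct.map ι.toLinearMap ι.toLinearMap (Coalgebra.comul (R := k) h) =
      (algSolution k s).inv * (1 ⊗ₜ[k] ι h) * (algSolution k s).val
  antipode_eq : ∀ (h : H) (a : Module.Dual k (Matrix S S k)),
    ι h = sliceLeft (algSolution k s).val a →
      ι (HopfAlgebra.antipode k h) = sliceLeft (algSolution k s).inv a

variable (k)

/-- The sums of matrix units `∑_{y ∈ ν(x', y')} S_{y ∘ x', y}`, for `x', y' ∈ S`, that span
`H_r(s)`; here `ν(x', y') = {y | ψ_y x' = ψ_{y'} x'}`. -/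
def rightSpanningSet (s : S × S → S × S) : Set (Matrix S S k) :=
  {m | ∃ x' y' : S, m = ∑ y ∈ Finset.univ.filter (fun y => psi s y x' = psi s y' x'),
    Matrix.single (circ s y x') y (1 : k)}

/-- The sums of matrix units `∑_{x ∈ μ(x', y')} S_{ψ_{y'} x, x}`, for `x', y' ∈ S`, that span
`H_ℓ(s)`; here `μ(x', y') = {x | y' ∘ x = y' ∘ x'}`. -/
def leftSpanningSet (s : S × S → S × S) : Set (Matrix S S k) :=
  {m | ∃ x' y' : S, m = ∑ x ∈ Finset.univ.filter (fun x => circ s y' x = circ s y' x'),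
    Matrix.single (psi s y' x) x (1 : k)}

/-- `∑ S_{y ∘ x', y}` over all `y` with `ψ_y = ψ_{y'}`. -/
def rightBasisElement (s : S × S → S × S) (y' x' : S) : Matrix S S k :=
  ∑ y ∈ Finset.univ.filter (fun y => psi s y = psi s y'), Matrix.single (circ s y x') y (1 : k)

open Classical in
/-- `∑ S_{ψ_{y'} x, x}` over all `x` of the form `e ∘ x'` with `e` idempotent. -/
noncomputable def leftBasisElement (s : S × S → S × S) (y' x' : S) : Matrix S S k :=
  ∑ x ∈ Finset.univ.filter (fun x => ∃ e, IsIdem s e ∧ circ s e x' = x),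
    Matrix.single (psi s y' x) x (1 : k)

end Coefficients

/-! ### Bases of Hopf algebras -/

section Bases

variable {k : Type v} [Field k] {H : Type w} [Ring H] [HopfAlgebra k H] {I : Type*}

/-- All the structure constants, with respect to the basis `b`, of all the structure maps of the
Hopf algebra `H` lie in the set `P` of scalars. -/
structure StructureConstantsIn (P : Set k) (b : Module.Basis I k H) : Prop where
  unit : ∀ i, b.repr 1 i ∈ P
  counit : ∀ i, Coalgebra.counit (R := k) (b i) ∈ P
  mul : ∀ i j l, b.repr (b i * b j) l ∈ P
  comul : ∀ i (p : I × I), (b.tensorProduct b).repr (Coalgebra.comul (R := k) (b i)) p ∈ P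
  antipode : ∀ i j, b.repr (HopfAlgebra.antipode k (b i)) j ∈ P

/-- The basis `b` is positive when `k` is viewed as a subfield of `ℂ` through `σ`: all structure
constants are nonnegative real numbers. -/
def IsPositiveBasis (σ : k →+* ℂ) (b : Module.Basis I k H) : Prop :=
  StructureConstantsIn {c : k | ∃ r : ℝ, 0 ≤ r ∧ σ c = r} b

variable (k H) in
/-- `Φ_H = (id ⊗ m)(Δ ⊗ id)`. -/
noncomputable def phi : H ⊗[k] H →ₗ[k] H ⊗[k] H :=
  LinearMap.lTensor H (LinearMap.mul' k H) ∘ₗ (TensorProduct.assoc k H H H).toLinearMap ∘ₗ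
    LinearMap.rTensor H (Coalgebra.comul (R := k) (A := H))

/-- `Φ_H` maps every `b i ⊗ b j` to a pure tensor of two elements of the basis. -/
def IsPhiSetTheoretic (b : Module.Basis I k H) : Prop :=
  ∀ i j, ∃ p q, phi k H (b i ⊗ₜ[k] b j) = b p ⊗ₜ[k] b q

end Bases

end PentagonHopf

namespace PentagonHopf

/-! ### Coordinates of the reversed pentagon equation -/

section Identities

variable {S : Type u} {s : S × S → S × S}

/-! The solution is governed by two groups: `A`, the permutations `ψ_z`, and `G`, the right
translations `ρ_x : y ↦ y ∘ x`. With `π y = ψ_y` one has `s (x, y) = (π y • x, ρ x • y)`; both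
groups act freely on `S`, and they act on each other as a matched pair (`nonempty_matchedSolution`).
Where `π y = a` and `ρ x = σ`, the map `s` is the product map `a × σ`. So `R = ∑ left i ⊗ right i`
over `i ∈ A × G`, where `left (a, σ)` is `x ↦ a • x` on `ρ x = σ` and `right (a, σ)` is `y ↦ σ • y`
on `π y = a` (`tensorOf_eq_sum`). Freeness makes both families independent, so they are bases of the
two coefficient spaces. The family `right` multiplies like the standard basis of a bicrossproduct of
the functions on `A` with the group algebra of `G`, and `left` like that of the swapped pair. The
structure constants 0 and 1 can then be read off, and conjugation by `R` gives the bicrossproduct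
comultiplication.

The hard point is that the `ρ_x` are bijective. The finite order of `s` makes `y ∘ x ∘ w = y`
solvable for `w`. The rational right coefficients of `s` span an algebra with a character, the
counit (`exists_counit_functional`). Its value at the diagonal matrix of the fibre sizes of `y ↦ y ∘
j` is 1; a character sends a diagonal matrix to one of its diagonal entries, so some fibre is a
singleton (`exists_card_fiber_eq_one`). These two facts make every idempotent a right identity
(`mul_idempotent_eq_self`), hence right translations injective. Injectivity of `s` then gives that
of each `ψ_z` (`psi_injective`). -/

theorem apply_eq (s : S × S → S × S) (x y : S) : s (x, y) = (psi s y x, circ s y x) := rfl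

theorem IsRPESolution.psi_psi (hs : IsRPESolution s) (x y z : S) :
    psi s (psi s z y) (psi s (circ s z y) x) = psi s y x :=
  congrArg (fun p => p.1) (congrFun hs (x, y, z))

theorem IsRPESolution.psi_circ (hs : IsRPESolution s) (x y z : S) :
    psi s z (circ s y x) = circ s (psi s z y) (psi s (circ s z y) x) :=
  (congrArg (fun p => p.2.1) (congrFun hs (x, y, z))).symm

theorem IsRPESolution.circ_assoc (hs : IsRPESolution s) (x y z : S) :
    circ s (circ s z y) x = circ s z (circ s y x) :=
  congrArg (fun p => p.2.2) (congrFun hs (x, y, z))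

end Identities

/-- Finite order turns the identity and the inverse into iterates of `s`, so closure under
composition with `s` is enough to reach them. -/
theorem exists_iterate_eq_id {S : Type u} [Finite S] (s : Equiv.Perm (S × S)) :
    ∃ n, (⇑s)^[n + 1] = id ∧ (⇑s)^[n] = s.symm := by
  have h0 : 0 < orderOf s := orderOf_pos s
  refine ⟨orderOf s - 1, ?_, ?_⟩
  · rw [Nat.sub_add_cancel h0, ← Equiv.Perm.coe_pow, pow_orderOf_eq_one]; rfl
  · rw [← Equiv.Perm.coe_pow, ← Equiv.Perm.inv_def,
      inv_eq_of_mul_eq_one_right (b := s ^ (orderOf s - 1))]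
    rw [← pow_succ', Nat.sub_add_cancel h0, pow_orderOf_eq_one]

/-! ### Coefficient matrices and the counit character -/

section CoefficientMatrices

variable {S : Type u} [DecidableEq S]

/-- The coefficient of the second leg of `t` at the matrix unit `S_{i,j}` of the first leg. -/
def rightCoeff (t : S × S → S × S) (i j : S) : Matrix S S ℚ :=
  Matrix.of fun b y => if t (j, y) = (i, b) then 1 else 0

/-- The coefficient of the first leg of `t` at the matrix unit `S_{i,j}` of the second leg. -/
def leftCoeff (t : S × S → S × S) (i j : S) : Matrix S S ℚ :=
  Matrix.of fun a x => if t (x, j) = (a, i) then 1 else 0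

theorem rightCoeff_id (i j : S) :
    rightCoeff (id : S × S → S × S) i j = if i = j then 1 else 0 := by
  ext b y
  by_cases h : i = j
  · subst h; simp [rightCoeff, Matrix.one_apply, eq_comm]
  · simp [rightCoeff, h, Ne.symm h]

theorem leftCoeff_id (i j : S) : leftCoeff (id : S × S → S × S) i j = if i = j then 1 else 0 := by
  ext b y
  by_cases h : i = j
  · subst h; simp [leftCoeff, Matrix.one_apply, eq_comm]
  · simp [leftCoeff, h, Ne.symm h]

theorem rightCoeff_symm (s : Equiv.Perm (S × S)) (i j : S) :
    rightCoeff s.symm i j = (rightCoeff s j i).transpose := by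
  ext b y
  simp only [rightCoeff, Matrix.of_apply, Matrix.transpose_apply, Equiv.symm_apply_eq]
  simp only [eq_comm]

variable [Fintype S]

theorem rightCoeff_comp (t s : S × S → S × S) (i j : S) :
    rightCoeff (t ∘ s) i j = ∑ l, rightCoeff t i l * rightCoeff s l j := by
  ext b y
  simp only [Matrix.sum_apply, Matrix.mul_apply, rightCoeff, Matrix.of_apply,
    Function.comp_apply]
  rw [← Fintype.sum_prod_type' (f := fun l c => (if t (l, c) = (i, b) then (1 : ℚ) else 0) *
    (if s (j, y) = (l, c) then 1 else 0))]
  rw [Finset.sum_eq_single (s (j, y))]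
  · simp
  · intro p _ hp; simp [Ne.symm hp]
  · simp

theorem leftCoeff_comp (t s : S × S → S × S) (i j : S) :
    leftCoeff (t ∘ s) i j = ∑ l, leftCoeff t i l * leftCoeff s l j := by
  ext a x
  simp only [Matrix.sum_apply, Matrix.mul_apply, leftCoeff, Matrix.of_apply,
    Function.comp_apply]
  rw [Finset.sum_comm]
  rw [← Fintype.sum_prod_type' (f := fun c l => (if t (c, l) = (a, i) then (1 : ℚ) else 0) *
    (if s (x, j) = (c, l) then 1 else 0))]
  rw [Finset.sum_eq_single (s (x, j))]
  · simp
  · intro p _ hp; simp [Ne.symm hp]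
  · simp

/-- This is the pentagon equation on matrix units, with the indices carried by `s⁻¹`. It makes the
span of the coefficients closed under products, without any choice of a basis. -/
theorem leftCoeff_mul_leftCoeff {s : Equiv.Perm (S × S)} (hs : IsRPESolution s) (i j k l : S) :
    leftCoeff s i j * leftCoeff s k l =
      if (s.symm (i, k)).2 = (s.symm (j, l)).2 then
        leftCoeff s (s.symm (i, k)).1 (s.symm (j, l)).1 else 0 := by
  obtain ⟨⟨y, z⟩, hyz⟩ := s.surjective (j, l)
  obtain ⟨⟨p, z'⟩, hp⟩ := s.surjective (i, k)
  rw [← hyz, ← hp, s.symm_apply_apply, s.symm_apply_apply]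
  have h1 : psi s z y = j := congrArg Prod.fst hyz
  have h2 : circ s z y = l := congrArg Prod.snd hyz
  have h3 : psi s z' p = i := congrArg Prod.fst hp
  have h4 : circ s z' p = k := congrArg Prod.snd hp
  subst h1 h2 h3 h4
  ext a x
  have key : (s (psi s (circ s z y) x, psi s z y) = (a, psi s z' p) ∧
      circ s (circ s z y) x = circ s z' p) ↔ (z' = z ∧ s (x, y) = (a, p)) := by
    rw [apply_eq s _ (psi s z y), hs.psi_psi, ← hs.psi_circ, hs.circ_assoc, apply_eq s x y]
    simp only [Prod.mk.injEq]
    constructor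
    · rintro ⟨⟨rfl, h⟩, h'⟩
      have := s.injective ((Prod.ext h h' : s (circ s y x, z) = s (p, z')))
      simp only [Prod.mk.injEq] at this
      exact ⟨this.2.symm, rfl, this.1⟩
    · rintro ⟨rfl, rfl, rfl⟩
      exact ⟨⟨rfl, rfl⟩, rfl⟩
  have hmul : (leftCoeff s (psi s z' p) (psi s z y) * leftCoeff s (circ s z' p) (circ s z y)) a x =
      if z' = z ∧ s (x, y) = (a, p) then 1 else 0 := by
    rw [Matrix.mul_apply, Finset.sum_eq_single (psi s (circ s z y) x), ← if_congr key rfl rfl]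
    · simp only [leftCoeff, Matrix.of_apply, apply_eq s x (circ s z y), Prod.mk.injEq, true_and]
      rw [ite_and]
      split_ifs <;> simp
    · intro c _ hc
      simp [leftCoeff, apply_eq s x (circ s z y), Ne.symm hc]
    · simp
  rw [hmul]
  by_cases h : z' = z
  · simp [h, leftCoeff]
  · simp [h]

theorem rightCoeff_mul_rightCoeff {s : Equiv.Perm (S × S)} (hs : IsRPESolution s) (i j k l : S) :
    rightCoeff s i j * rightCoeff s k l =
      if (s (i, k)).1 = (s (j, l)).1 then rightCoeff s (s (i, k)).2 (s (j, l)).2 else 0 := by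
  ext b y
  have key : (s (l, y) = (k, circ s y l) ∧ s (j, circ s y l) = (i, b)) ↔
      (psi s k i = psi s l j ∧ s (circ s l j, y) = (circ s k i, b)) := by
    rw [apply_eq s l y, apply_eq s j, apply_eq s (circ s l j)]
    simp only [Prod.mk.injEq, and_true]
    constructor
    · rintro ⟨rfl, rfl, rfl⟩
      exact ⟨hs.psi_psi j l y, hs.psi_circ j l y, (hs.circ_assoc j l y).symm⟩
    · rintro ⟨h1, h2, rfl⟩
      have : s (psi s (circ s y l) j, psi s y l) = s (i, k) := by
        rw [apply_eq s _ (psi s y l), apply_eq s i k, hs.psi_psi, h1, ← h2, hs.psi_circ]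
      have := s.injective this
      simp only [Prod.mk.injEq] at this
      exact ⟨this.2, this.1, hs.circ_assoc j l y⟩
  have hmul : (rightCoeff s i j * rightCoeff s k l) b y =
      if psi s k i = psi s l j ∧ s (circ s l j, y) = (circ s k i, b) then 1 else 0 := by
    rw [Matrix.mul_apply, Finset.sum_eq_single (circ s y l), ← if_congr key rfl rfl]
    · simp only [rightCoeff, Matrix.of_apply]
      rw [ite_and]
      split_ifs <;> simp
    · intro c _ hc
      simp [rightCoeff, apply_eq s l y, Ne.symm hc]
    · simp
  rw [hmul, apply_eq s i k, apply_eq s j l]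
  by_cases h : psi s k i = psi s l j
  · simp [h, rightCoeff]
  · simp [h]

theorem leftCoeff_iterate_mem_span {s : Equiv.Perm (S × S)} (hs : IsRPESolution s) (n : ℕ)
    (i j : S) :
    leftCoeff (s^[n + 1]) i j ∈
      Submodule.span ℚ (Set.range fun p : S × S => leftCoeff s p.1 p.2) := by
  induction n generalizing i j with
  | zero => exact Submodule.subset_span ⟨(i, j), rfl⟩
  | succ n ih =>
    rw [Function.iterate_succ, leftCoeff_comp]
    refine Submodule.sum_mem _ fun l _ => ?_
    have h := Submodule.mul_mem_mul (ih i l)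
      (Submodule.subset_span (R := ℚ) (s := Set.range fun p : S × S => leftCoeff s p.1 p.2)
        ⟨(l, j), rfl⟩)
    rw [Submodule.span_mul_span] at h
    refine Submodule.span_le.2 ?_ h
    rintro _ ⟨_, ⟨p, rfl⟩, _, ⟨q, rfl⟩, rfl⟩
    simp only [leftCoeff_mul_leftCoeff hs]
    split_ifs
    · exact Submodule.subset_span ⟨(_, _), rfl⟩
    · exact Submodule.zero_mem _

/-- The entry `(i, j)` of `leftCoeff s p q` is the entry `(p, q)` of `rightCoeff s i j`. So an
expansion of the identity matrix in left coefficients is a functional on matrices with the required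
values, even if the right coefficients are linearly dependent. -/
theorem exists_counit_functional [Nonempty S] {s : Equiv.Perm (S × S)} (hs : IsRPESolution s) :
    ∃ f : Matrix S S ℚ →ₗ[ℚ] ℚ, ∀ i j, f (rightCoeff s i j) = if i = j then 1 else 0 := by
  obtain ⟨n, hn, -⟩ := exists_iterate_eq_id s
  obtain ⟨x⟩ := ‹Nonempty S›
  have h := leftCoeff_iterate_mem_span hs n x x
  rw [hn, leftCoeff_id, if_pos rfl, Submodule.mem_span_range_iff_exists_fun] at h
  obtain ⟨c, hc⟩ := h
  refine ⟨∑ p : S × S, c p • Matrix.entryLinearMap ℚ ℚ p.1 p.2, fun i j => ?_⟩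
  have := congrFun (congrFun hc i) j
  rw [Matrix.one_apply, Matrix.sum_apply] at this
  rw [← this]
  simp [leftCoeff, rightCoeff]

/-- The span of the right coefficients. -/
def rightCoeffSubmodule (s : S × S → S × S) : Submodule ℚ (Matrix S S ℚ) :=
  Submodule.span ℚ (Set.range fun p : S × S => rightCoeff s p.1 p.2)

theorem mul_mem_rightCoeffSubmodule {s : Equiv.Perm (S × S)} (hs : IsRPESolution s)
    {a b : Matrix S S ℚ} (ha : a ∈ rightCoeffSubmodule s) (hb : b ∈ rightCoeffSubmodule s) :
    a * b ∈ rightCoeffSubmodule s := by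
  have h := Submodule.mul_mem_mul ha hb
  rw [rightCoeffSubmodule, Submodule.span_mul_span] at h
  refine Submodule.span_le.2 ?_ h
  rintro _ ⟨_, ⟨p, rfl⟩, _, ⟨q, rfl⟩, rfl⟩
  simp only [rightCoeff_mul_rightCoeff hs]
  split_ifs
  · exact Submodule.subset_span ⟨(_, _), rfl⟩
  · exact Submodule.zero_mem _

/-- On coefficients this is the injectivity of `s`: the pairs `(i, k)` and `(j, l)` have the same
image only if they are equal. -/
theorem counit_functional_mul {s : Equiv.Perm (S × S)} (hs : IsRPESolution s)
    {f : Matrix S S ℚ →ₗ[ℚ] ℚ} (hf : ∀ i j, f (rightCoeff s i j) = if i = j then 1 else 0)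
    {a b : Matrix S S ℚ} (ha : a ∈ rightCoeffSubmodule s) (hb : b ∈ rightCoeffSubmodule s) :
    f (a * b) = f a * f b := by
  induction ha, hb using Submodule.span_induction₂ with
  | mem_mem x y hx hy =>
    obtain ⟨⟨i, j⟩, rfl⟩ := hx
    obtain ⟨⟨k, l⟩, rfl⟩ := hy
    simp only [rightCoeff_mul_rightCoeff hs, hf]
    have : (s (i, k)).1 = (s (j, l)).1 ∧ (s (i, k)).2 = (s (j, l)).2 ↔ i = j ∧ k = l := by
      rw [← Prod.ext_iff, s.apply_eq_iff_eq, Prod.mk.injEq]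
    by_cases h1 : (s (i, k)).1 = (s (j, l)).1 <;> by_cases h2 : (s (i, k)).2 = (s (j, l)).2 <;>
      by_cases h3 : i = j <;> by_cases h4 : k = l <;> simp_all
  | zero_left => simp
  | zero_right => simp
  | add_left x y z _ _ _ h1 h2 => simp [add_mul, h1, h2]
  | add_right x y z _ _ _ h1 h2 => simp [mul_add, h1, h2]
  | smul_left r x y _ _ h => simp [h, mul_assoc]
  | smul_right r x y _ _ h => simp [h, mul_left_comm]

theorem rightCoeff_iterate_mem {s : Equiv.Perm (S × S)} (hs : IsRPESolution s) (n : ℕ)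
    (i j : S) :
    rightCoeff (s^[n + 1]) i j ∈ rightCoeffSubmodule s := by
  induction n generalizing i j with
  | zero => exact Submodule.subset_span ⟨(i, j), rfl⟩
  | succ n ih =>
    rw [Function.iterate_succ, rightCoeff_comp]
    exact Submodule.sum_mem _ fun l _ =>
      mul_mem_rightCoeffSubmodule hs (ih i l) (Submodule.subset_span ⟨(l, j), rfl⟩)

theorem one_mem_rightCoeffSubmodule [Nonempty S] {s : Equiv.Perm (S × S)} (hs : IsRPESolution s) :
    (1 : Matrix S S ℚ) ∈ rightCoeffSubmodule s := by
  obtain ⟨n, hn, -⟩ := exists_iterate_eq_id s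
  obtain ⟨x⟩ := ‹Nonempty S›
  have h := rightCoeff_iterate_mem hs n x x
  rwa [hn, rightCoeff_id, if_pos rfl] at h

theorem counit_functional_iterate {s : Equiv.Perm (S × S)} (hs : IsRPESolution s)
    {f : Matrix S S ℚ →ₗ[ℚ] ℚ} (hf : ∀ i j, f (rightCoeff s i j) = if i = j then 1 else 0)
    (n : ℕ) (i j : S) : f (rightCoeff (s^[n + 1]) i j) = if i = j then 1 else 0 := by
  induction n generalizing i j with
  | zero => exact hf i j
  | succ n ih =>
    rw [Function.iterate_succ, rightCoeff_comp, map_sum]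
    simp_rw [counit_functional_mul hs hf (rightCoeff_iterate_mem hs n _ _)
      (Submodule.subset_span ⟨(_, j), rfl⟩), ih, hf]
    simp

theorem counit_functional_one [Nonempty S] {s : Equiv.Perm (S × S)} (hs : IsRPESolution s)
    {f : Matrix S S ℚ →ₗ[ℚ] ℚ} (hf : ∀ i j, f (rightCoeff s i j) = if i = j then 1 else 0) :
    f 1 = 1 := by
  obtain ⟨n, hn, -⟩ := exists_iterate_eq_id s
  obtain ⟨x⟩ := ‹Nonempty S›
  have h := counit_functional_iterate hs hf n x x
  rwa [hn, rightCoeff_id, if_pos rfl, if_pos rfl] at h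

theorem transpose_rightCoeff_eq {s : Equiv.Perm (S × S)} :
    ∃ n, ∀ i j, (rightCoeff s i j).transpose = rightCoeff (s^[n + 1]) j i := by
  obtain ⟨n, hn, hn'⟩ := exists_iterate_eq_id s
  -- The inverse is the iterate `n`, but `n = 0` is possible; adding a full period `n + 1` makes the
  -- exponent positive.
  refine ⟨n + n, fun i j => ?_⟩
  rw [← rightCoeff_symm, show n + n + 1 = (n + 1) + n by omega, Function.iterate_add, hn, hn']
  rfl

/-- The counit of `H_r(s)` detects an element of `S` that is divisible by `j` in only one way. -/
theorem exists_card_fiber_eq_one {s : Equiv.Perm (S × S)} (hs : IsRPESolution s) (j : S) :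
    ∃ w, (Finset.univ.filter fun y => circ s y j = w).card = 1 := by
  have : Nonempty S := ⟨j⟩
  obtain ⟨f, hf⟩ := exists_counit_functional hs
  let d : S → ℚ := fun w => (Finset.univ.filter fun y => circ s y j = w).card
  have hd : Matrix.diagonal d = ∑ i, rightCoeff s i j * (rightCoeff s i j).transpose := by
    ext b c
    simp only [Matrix.sum_apply, Matrix.mul_apply, Matrix.transpose_apply, rightCoeff,
      Matrix.of_apply, apply_eq, Prod.mk.injEq]
    rw [Finset.sum_comm]
    have : ∀ y, ∑ i, (if psi s y j = i ∧ circ s y j = b then (1 : ℚ) else 0) *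
        (if psi s y j = i ∧ circ s y j = c then 1 else 0) =
        if circ s y j = b ∧ b = c then 1 else 0 := by
      intro y
      rw [Finset.sum_eq_single (psi s y j)]
      · by_cases h : circ s y j = b
        · simp [h]
        · simp [h]
      · intro i _ hi; simp [Ne.symm hi]
      · simp
    simp_rw [this]
    by_cases h : b = c
    · subst h; simp [d]
    · simp [h]
  obtain ⟨n, hn⟩ := transpose_rightCoeff_eq (s := s)
  have hmem : ∀ i k, rightCoeff s i k ∈ rightCoeffSubmodule s := fun i k =>
    Submodule.subset_span ⟨(i, k), rfl⟩
  have hDmem : Matrix.diagonal d ∈ rightCoeffSubmodule s := by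
    rw [hd]
    refine Submodule.sum_mem _ fun i _ => mul_mem_rightCoeffSubmodule hs (hmem _ _) ?_
    rw [hn]; exact rightCoeff_iterate_mem hs _ _ _
  have hfD : f (Matrix.diagonal d) = 1 := by
    rw [hd, map_sum]
    have : ∀ i, f (rightCoeff s i j * (rightCoeff s i j).transpose) = if i = j then 1 else 0 := by
      intro i
      rw [hn, counit_functional_mul hs hf (hmem _ _) (rightCoeff_iterate_mem hs _ _ _), hf,
        counit_functional_iterate hs hf]
      simp [eq_comm]
    simp [this]
  let W : Subalgebra ℚ (Matrix S S ℚ) := (rightCoeffSubmodule s).toSubalgebra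
    (one_mem_rightCoeffSubmodule hs) fun _ _ => mul_mem_rightCoeffSubmodule hs
  let φ : W →ₐ[ℚ] ℚ := AlgHom.ofLinearMap (f ∘ₗ W.val.toLinearMap)
    (counit_functional_one hs hf) fun a b => counit_functional_mul hs hf a.2 b.2
  let D : W := ⟨Matrix.diagonal d, hDmem⟩
  -- The polynomial `p` annihilates `D`, so the value 1 of the character at `D` is a root of `p`,
  -- that is, a fibre size.
  let p : Polynomial ℚ := ∏ w, (Polynomial.X - Polynomial.C (d w))
  have hpd : Polynomial.aeval d p = 0 := by
    funext w
    rw [show Polynomial.aeval d p w = Polynomial.aeval (d w) p from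
      (Polynomial.aeval_algHom_apply (Pi.evalAlgHom ℚ (fun _ : S => ℚ) w) d p).symm]
    simp only [p, map_prod]
    exact Finset.prod_eq_zero (Finset.mem_univ w) (by simp)
  have hpD : Polynomial.aeval D p = 0 := by
    apply Subtype.val_injective
    have h1 := Polynomial.aeval_algHom_apply W.val D p
    have h2 := Polynomial.aeval_algHom_apply (Matrix.diagonalAlgHom ℚ (n := S) (α := ℚ)) d p
    rw [hpd, map_zero] at h2
    exact h1.symm.trans h2
  have h3 := Polynomial.aeval_algHom_apply φ D p
  rw [hpD, map_zero, show φ D = 1 from hfD] at h3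
  simp only [p, map_prod] at h3
  obtain ⟨w, -, hw⟩ := Finset.prod_eq_zero_iff.1 h3
  refine ⟨w, ?_⟩
  simp only [map_sub, Polynomial.aeval_X, Polynomial.aeval_C] at hw
  have : d w = 1 := (sub_eq_zero.1 hw).symm
  exact Nat.cast_injective (R := ℚ) (this.trans Nat.cast_one.symm)

end CoefficientMatrices

/-! ### Finite semigroups whose idempotents are right identities -/

section FiniteSemigroup

variable {S : Type u} [Semigroup S] [Finite S]

/-- In a finite semigroup every element has a multiple by one of its powers that is idempotent. -/
theorem exists_mul_idempotent (c : S) :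
    ∃ d, c * d = d * c ∧ c * d * (c * d) = c * d ∧ ∀ x, x * c = x → x * d = x := by
  -- A semigroup has no zeroth power: `pw n` stands for `c ^ (n + 1)`.
  obtain ⟨pw, pw_zero, pw_succ⟩ : ∃ pw : ℕ → S, pw 0 = c ∧ ∀ n, pw (n + 1) = pw n * c :=
    ⟨fun n => Nat.rec c (fun _ x => x * c) n, rfl, fun _ => rfl⟩
  have pw_mul : ∀ m n, pw m * pw n = pw (m + n + 1) := by
    intro m n
    induction n with
    | zero => rw [pw_zero, add_zero, pw_succ]
    | succ n ih => rw [pw_succ, ← mul_assoc, ih, ← pw_succ, ← add_assoc]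
  obtain ⟨i, j, hij, h⟩ : ∃ i j, i < j ∧ pw i = pw j := by
    obtain ⟨i, j, hne, h⟩ := Finite.exists_ne_map_eq_of_infinite pw
    rcases lt_or_gt_of_ne hne with hlt | hlt
    · exact ⟨i, j, hlt, h⟩
    · exact ⟨j, i, hlt, h.symm⟩
  obtain ⟨p, rfl⟩ : ∃ p, j = i + (p + 1) := ⟨j - i - 1, by omega⟩
  have hper : ∀ m, i < m → pw (m + (p + 1)) = pw m := by
    intro m hm
    obtain ⟨r, rfl⟩ : ∃ r, m = i + r + 1 := ⟨m - i - 1, by omega⟩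
    rw [← pw_mul i r, h, pw_mul]
    congr 1; omega
  have hper' : ∀ t m, i < m → pw (m + t * (p + 1)) = pw m := by
    intro t m hm
    induction t with
    | zero => simp
    | succ t ih => rw [Nat.succ_mul, ← add_assoc, hper _ (by omega), ih]
  -- The exponent `q + 2` of `c * pw q` is a multiple of the period `p + 1` beyond the preperiod, so
  -- squaring changes nothing. The factor `i + 3` only provides the size.
  obtain ⟨q, hq⟩ : ∃ q, q + 2 = (i + 3) * (p + 1) :=
    ⟨(i + 3) * (p + 1) - 2,
      Nat.sub_add_cancel (le_trans (by omega) (Nat.le_mul_of_pos_right _ p.succ_pos))⟩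
  have hqi : i < q + 1 := by nlinarith
  have h0 : c * pw q = pw (q + 1) := by
    rw [← pw_zero, pw_mul]; congr 1; omega
  have h0' : pw q * c = pw (q + 1) := (pw_succ q).symm
  refine ⟨pw q, h0.trans h0'.symm, ?_, ?_⟩
  · rw [h0, pw_mul, show q + 1 + (q + 1) + 1 = (q + 1) + (q + 2) by omega, hq, hper' _ _ hqi]
  · intro x hx
    generalize q = n
    induction n with
    | zero => rw [pw_zero, hx]
    | succ n ih => rw [pw_succ, ← mul_assoc, ih, hx]

/-- A singleton fibre of `y ↦ y * e` gives `y₀` such that `y₀` is the only solution of `y * e = y₀`.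
This makes `y₀` a left multiple of every element. Let `f = y₀ * d₀` be an idempotent power of `y₀`.
Any `x` is fixed on the right by an idempotent `g` in `y₀ S`; then `f * g = g` since `f * y₀ = y₀`,
and `f * g = f` since `y₀` is a left multiple of `g`. So `x * f = x`, and `f * e = f` transfers this
to `e`. -/
theorem mul_idempotent_eq_self (ha : ∀ y x : S, ∃ w, y * x * w = y)
    (hb : ∀ j : S, ∃ w, ∃! y, y * j = w) {e : S} (he : e * e = e) (x : S) : x * e = x := by
  obtain ⟨w₀, y₀, hy₀, huniq⟩ := hb e
  have hy₀e : y₀ * e = y₀ := huniq _ (by simp only [mul_assoc, he]; exact hy₀)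
  obtain rfl : y₀ = w₀ := hy₀e.symm.trans hy₀
  have hdiv : ∀ y₁, ∃ u, u * y₁ = y₀ := by
    intro y₁
    obtain ⟨d, hcomm, hidem, -⟩ := exists_mul_idempotent (e * y₁ * e)
    have heg : e * (e * y₁ * e * d) = e * y₁ * e * d := by
      simp only [← mul_assoc, he]
    have hge : e * y₁ * e * d * e = e * y₁ * e * d := by
      rw [hcomm]; simp only [mul_assoc, he]
    -- An idempotent `g` with `g * e = g` and `g * w = e` equals `e`.
    have hg : e * y₁ * e * d = e := by
      obtain ⟨w, hw⟩ := ha e (e * y₁ * e * d)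
      rw [heg] at hw
      calc e * y₁ * e * d = e * y₁ * e * d * (e * y₁ * e * d * w) := by rw [hw, hge]
        _ = e := by rw [← mul_assoc _ _ w, hidem, hw]
    refine ⟨y₀ * d * e, huniq _ ?_⟩
    simp only [mul_assoc] at hcomm hg ⊢
    rw [← hcomm, hg, hy₀e]
  obtain ⟨d₀, hcomm₀, hidem₀, -⟩ := exists_mul_idempotent y₀
  have hf : y₀ * d₀ * y₀ = y₀ := by
    obtain ⟨w, hw⟩ := ha y₀ d₀
    calc y₀ * d₀ * y₀ = y₀ * d₀ * (y₀ * d₀ * w) := by rw [hw]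
      _ = y₀ := by rw [← mul_assoc, hidem₀, hw]
  have hxf : ∀ x, x * (y₀ * d₀) = x := by
    intro x
    obtain ⟨w, hw⟩ := ha x y₀
    obtain ⟨d, hcomm, hidem, hfix⟩ := exists_mul_idempotent (y₀ * w)
    have hxc : x * (y₀ * w) = x := by rw [← mul_assoc, hw]
    have hxg : x * (y₀ * w * d) = x := by rw [← mul_assoc x, hxc, hfix x hxc]
    have hfg : y₀ * d₀ * (y₀ * w * d) = y₀ * w * d := by
      rw [← mul_assoc, ← mul_assoc, hf]
    obtain ⟨u, hu⟩ := hdiv (y₀ * w * d)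
    have hyg : y₀ * (y₀ * w * d) = y₀ := by
      calc y₀ * (y₀ * w * d) = u * (y₀ * w * d) * (y₀ * w * d) := by rw [hu]
        _ = y₀ := by rw [mul_assoc u, hidem, hu]
    have hfg' : y₀ * d₀ * (y₀ * w * d) = y₀ * d₀ := by
      rw [hcomm₀, mul_assoc, hyg]
    rw [← hfg', hfg, hxg]
  have hfe : y₀ * d₀ * e = y₀ * d₀ := by rw [hcomm₀, mul_assoc, hy₀e]
  calc x * e = x * (y₀ * d₀) * e := by rw [hxf]
    _ = x := by rw [mul_assoc, hfe, hxf]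

theorem mul_right_cancel_of_exists_fiber (ha : ∀ y x : S, ∃ w, y * x * w = y)
    (hb : ∀ j : S, ∃ w, ∃! y, y * j = w) (j : S) : Function.Injective fun y => y * j := by
  intro y₁ y₂ h
  obtain ⟨d, -, hidem, -⟩ := exists_mul_idempotent j
  have h' := congrArg (· * d) h
  simp only [mul_assoc] at h'
  rwa [mul_idempotent_eq_self ha hb hidem, mul_idempotent_eq_self ha hb hidem] at h'

end FiniteSemigroup

/-! ### The left group `(S, ∘)` and the permutations `ψ_z` -/

section LeftGroup

variable {S : Type u} {s : Equiv.Perm (S × S)}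

/-- The semigroup `(S, ∘)`. -/
@[reducible]
def IsRPESolution.semigroup {s : S × S → S × S} (hs : IsRPESolution s) : Semigroup S where
  mul := circ s
  mul_assoc a b c := hs.circ_assoc c b a

/-- Iterating `s` only multiplies the second coordinate on the right, and the finite order of `s`
brings it back to `y`. -/
theorem exists_circ_circ_eq [Finite S] (hs : IsRPESolution s) (y x : S) :
    ∃ w, circ s (circ s y x) w = y := by
  classical
  have := Fintype.ofFinite S
  have hit : ∀ n x y, ((s : S × S → S × S)^[n] (x, y)).2 = y ∨
      ∃ w, ((s : S × S → S × S)^[n] (x, y)).2 = circ s y w := by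
    intro n
    induction n with
    | zero => intro x y; exact Or.inl rfl
    | succ n ih =>
      intro x y
      right
      rw [Function.iterate_succ_apply, apply_eq s x y]
      rcases ih (psi s y x) (circ s y x) with h | ⟨w, h⟩
      · exact ⟨x, h⟩
      · exact ⟨circ s x w, by rw [h, hs.circ_assoc]⟩
  obtain ⟨n, hn, -⟩ := exists_iterate_eq_id s
  have h := hit n (psi s y x) (circ s y x)
  rw [← apply_eq, ← Function.iterate_succ_apply, hn] at h
  rcases h with h | ⟨w, h⟩
  · exact ⟨x, by rw [← show y = circ s y x from h]; exact h.symm⟩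
  · exact ⟨w, h.symm⟩

theorem circ_left_injective [Finite S] (hs : IsRPESolution s) (x : S) :
    Function.Injective fun y => circ s y x := by
  classical
  have := Fintype.ofFinite S
  let _ : Semigroup S := hs.semigroup
  refine mul_right_cancel_of_exists_fiber (exists_circ_circ_eq hs) (fun j => ?_) x
  obtain ⟨w, hw⟩ := exists_card_fiber_eq_one hs j
  obtain ⟨y, hy⟩ := Finset.card_eq_one.1 hw
  have hmem : ∀ y', circ s y' j = w ↔ y' = y := fun y' => by
    simpa using Finset.ext_iff.1 hy y'
  exact ⟨w, y, (hmem y).2 rfl, fun y' hy' => (hmem y').1 hy'⟩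

theorem exists_isIdem [Finite S] [Nonempty S] (hs : IsRPESolution s) : ∃ e, IsIdem s e := by
  let _ : Semigroup S := hs.semigroup
  obtain ⟨c⟩ := ‹Nonempty S›
  obtain ⟨d, -, h, -⟩ := exists_mul_idempotent c
  exact ⟨_, h⟩

variable [Finite S] (hs : IsRPESolution s)

/-- The right translation `y ↦ y ∘ x`. -/
noncomputable def rho (x : S) : Equiv.Perm S :=
  Equiv.ofBijective (fun y => circ s y x)
    (Finite.injective_iff_bijective.1 (circ_left_injective hs x))

theorem rho_apply (x y : S) : rho hs x y = circ s y x := rfl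

theorem rho_rho (x y : S) : rho hs (rho hs x y) = rho hs x * rho hs y := by
  ext z
  exact (hs.circ_assoc x y z).symm

theorem isIdem_iff {e : S} : IsIdem s e ↔ rho hs e = 1 := by
  constructor
  · intro h
    have := rho_rho hs e e
    rw [show rho hs e e = e from h] at this
    exact mul_eq_left.1 this.symm
  · intro h
    exact Equiv.ext_iff.1 h e

theorem exists_rho_eq_inv (x : S) : ∃ w, rho hs w = (rho hs x)⁻¹ := by
  obtain ⟨w, hw⟩ := exists_circ_circ_eq hs x x
  refine ⟨w, eq_inv_of_mul_eq_one_left ?_⟩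
  have h := rho_rho hs w (rho hs x x)
  rw [show rho hs w (rho hs x x) = x from hw, rho_rho, ← mul_assoc] at h
  exact mul_eq_right.1 h.symm

/-- The idempotent `f` with `f ∘ x = x`. -/
theorem rho_inv_apply_self (x : S) : rho hs ((rho hs x)⁻¹ x) = 1 := by
  obtain ⟨w, hw⟩ := exists_rho_eq_inv hs x
  rw [← hw, rho_rho, hw, inv_mul_cancel]

/-- `ψ_z (y ∘ x) = ψ_z y ∘ ψ_{z ∘ y} x`. -/
theorem psi_rho (x y z : S) :
    psi s z (rho hs x y) = rho hs (psi s (rho hs y z) x) (psi s z y) :=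
  hs.psi_circ x y z

theorem rho_psi_eq_one {f : S} (hf : rho hs f = 1) (z : S) : rho hs (psi s z f) = 1 := by
  have h := psi_rho hs f f z
  rw [hf] at h
  have h2 := rho_rho hs (psi s z f) (psi s z f)
  rw [show rho hs (psi s z f) (psi s z f) = psi s z f from h.symm] at h2
  exact mul_eq_left.1 h2.symm

/-- An idempotent `f` satisfies `z ∘ f = z`, so `s (f, z) = (ψ_z f, z)`. -/
theorem psi_injOn_idempotents (hs : IsRPESolution s) {f f' : S} (hf : rho hs f = 1)
    (hf' : rho hs f' = 1) {z : S}
    (h : psi s z f = psi s z f') : f = f' := by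
  have : s (f, z) = s (f', z) := by
    rw [apply_eq s f z, apply_eq s f' z, h, ← rho_apply hs, ← rho_apply hs, hf, hf']
  exact congrArg Prod.fst (s.injective this)

/-- The map `ψ_{z ∘ k}` permutes the finite set of idempotents, so `ψ_z k = ψ_{z ∘ k} f` for an
idempotent `f`. Then `s (f, z ∘ k) = s (k, z)`, and `k = f`. -/
theorem rho_eq_one_of_rho_psi_eq_one {k z : S} (h : rho hs (psi s z k) = 1) : rho hs k = 1 := by
  let E := {f : S // rho hs f = 1}
  let g : E → E := fun f => ⟨psi s (rho hs k z) f, rho_psi_eq_one hs f.2 _⟩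
  have hg : Function.Injective g := fun f f' hff' =>
    Subtype.ext (psi_injOn_idempotents hs f.2 f'.2 (congrArg Subtype.val hff'))
  obtain ⟨f, hf⟩ := (Finite.injective_iff_surjective.1 hg) ⟨psi s z k, h⟩
  have h1 : s (f.1, rho hs k z) = s (k, z) := by
    rw [apply_eq s f.1, apply_eq s k z]
    refine Prod.ext (congrArg Subtype.val hf) ?_
    change rho hs f.1 (rho hs k z) = circ s z k
    rw [f.2]; rfl
  have h2 : f.1 = k := congrArg Prod.fst (s.injective h1)
  rw [← h2]; exact f.2

/-- Write `x = f ∘ x` with `f` idempotent. Then `ψ_z x = ψ_z f ∘ ψ_z x` recovers `f`, so `x` and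
`x'` share it and `x' = x ∘ k`. Now `ψ_z x' = ψ_z x ∘ ψ_{z ∘ x} k` forces `ψ_{z ∘ x} k`, hence `k`,
to be idempotent, and `x' = x`. -/
theorem psi_injective (hs : IsRPESolution s) (z : S) : Function.Injective (psi s z) := by
  intro x x' h
  have hdec : ∀ x, psi s z x = rho hs (psi s z x) (psi s z ((rho hs x)⁻¹ x)) := by
    intro x
    have hx : rho hs x ((rho hs x)⁻¹ x) = x := Equiv.apply_symm_apply _ _
    have h1 := psi_rho hs x ((rho hs x)⁻¹ x) z
    rw [rho_inv_apply_self, hx] at h1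
    exact h1
  have hf : (rho hs x)⁻¹ x = (rho hs x')⁻¹ x' := by
    refine psi_injOn_idempotents hs (rho_inv_apply_self hs x) (rho_inv_apply_self hs x') (z := z) ?_
    apply (rho hs (psi s z x)).injective
    rw [← hdec, h, ← hdec]
  obtain ⟨w, hw⟩ := exists_rho_eq_inv hs x
  have hk : x' = rho hs (rho hs x' w) x := by
    rw [rho_rho, hw, Equiv.Perm.mul_apply, hf]
    exact (Equiv.apply_symm_apply _ _).symm
  have h1 := psi_rho hs (rho hs x' w) x z
  rw [← hk, ← h] at h1
  have h2 := rho_rho hs (psi s (rho hs x z) (rho hs x' w)) (psi s z x)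
  rw [← h1] at h2
  have h3 := rho_eq_one_of_rho_psi_eq_one hs (mul_eq_right.1 h2.symm)
  rw [hk, h3]; rfl

/-- The permutation `ψ_z`. -/
noncomputable def psiPerm (z : S) : Equiv.Perm S :=
  Equiv.ofBijective (psi s z) (Finite.injective_iff_bijective.1 (psi_injective hs z))

theorem psiPerm_mul (y z : S) :
    psiPerm hs (psiPerm hs z y) * psiPerm hs (rho hs y z) = psiPerm hs y := by
  ext x
  exact hs.psi_psi x y z

theorem psiPerm_psiPerm (y z : S) :
    psiPerm hs (psiPerm hs z y) = psiPerm hs y * (psiPerm hs (rho hs y z))⁻¹ :=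
  eq_mul_inv_of_mul_eq (psiPerm_mul hs y z)

theorem psiPerm_rho (x y z : S) :
    psiPerm hs z (rho hs x y) = rho hs (psiPerm hs (rho hs y z) x) (psiPerm hs z y) :=
  psi_rho hs x y z

theorem exists_idempotent_psiPerm_eq_one [Nonempty S] :
    ∃ e, rho hs e = 1 ∧ psiPerm hs e = 1 := by
  obtain ⟨e, he⟩ := exists_isIdem hs
  have h := psiPerm_mul hs e e
  rw [show rho hs e e = e from he] at h
  exact ⟨psiPerm hs e e, rho_psi_eq_one hs ((isIdem_iff hs).1 he) e, mul_eq_right.1 h⟩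

theorem psiPerm_psiPerm_idempotent {f : S} (hf : rho hs f = 1) (z : S) :
    psiPerm hs (psiPerm hs z f) = psiPerm hs f * (psiPerm hs z)⁻¹ := by
  rw [psiPerm_psiPerm, hf]; rfl

theorem exists_idempotent_psiPerm_eq [Nonempty S] (z : S) :
    ∃ f, rho hs f = 1 ∧ psiPerm hs f = psiPerm hs z := by
  obtain ⟨e, he, he'⟩ := exists_idempotent_psiPerm_eq_one hs
  -- As `ψ_e = 1`, passing from `z` to `ψ_z e` inverts the permutation; doing so twice restores
  -- `ψ_z`.
  refine ⟨psiPerm hs (psiPerm hs z e) e, rho_psi_eq_one hs he _, ?_⟩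
  rw [psiPerm_psiPerm_idempotent hs he, psiPerm_psiPerm_idempotent hs he, he', one_mul, one_mul,
    inv_inv]

end LeftGroup

/-! ### Matched pairs and their bicrossproduct Hopf algebras -/

/-- A matched pair of groups, with both actions written as left actions. -/
structure MatchedPair (A G : Type*) [Group A] [Group G] where
  /-- The action of `A` on `G`. -/
  actG : A → G → G
  /-- The action of `G` on `A`. -/
  actA : G → A → A
  one_actG : ∀ σ, actG 1 σ = σ
  mul_actG : ∀ a b σ, actG (a * b) σ = actG a (actG b σ)
  one_actA : ∀ a, actA 1 a = a
  mul_actA : ∀ σ τ a, actA (σ * τ) a = actA σ (actA τ a)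
  actA_mul : ∀ σ a b, actA σ (a * b) = actA (actG b σ) a * actA σ b
  actG_mul : ∀ a σ τ, actG a (σ * τ) = actG (actA τ a) σ * actG a τ

namespace MatchedPair

variable {A G : Type*} [Group A] [Group G] (P : MatchedPair A G)

/-- Exchange the two groups. -/
def swap : MatchedPair G A where
  actG := P.actA
  actA := P.actG
  one_actG := P.one_actA
  mul_actG := P.mul_actA
  one_actA := P.one_actG
  mul_actA := P.mul_actG
  actA_mul := P.actG_mul
  actG_mul := P.actA_mul

theorem actG_one (a : A) : P.actG a 1 = 1 := by
  have h := P.actG_mul a 1 1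
  rw [P.one_actA, mul_one] at h
  exact mul_eq_left.1 h.symm

theorem actA_one (σ : G) : P.actA σ 1 = 1 := P.swap.actG_one σ

theorem actG_inv_actG (a : A) (σ : G) : P.actG a⁻¹ (P.actG a σ) = σ := by
  rw [← P.mul_actG, inv_mul_cancel, P.one_actG]

theorem actG_actG_inv (a : A) (σ : G) : P.actG a (P.actG a⁻¹ σ) = σ := by
  rw [← P.mul_actG, mul_inv_cancel, P.one_actG]

theorem actA_inv_actA (σ : G) (a : A) : P.actA σ⁻¹ (P.actA σ a) = a := P.swap.actG_inv_actG σ a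

theorem actA_actA_inv (σ : G) (a : A) : P.actA σ (P.actA σ⁻¹ a) = a := P.swap.actG_actG_inv σ a

theorem actA_eq_one_iff {σ : G} {a : A} : P.actA σ a = 1 ↔ a = 1 :=
  ⟨fun h => by rw [← P.actA_inv_actA σ a, h, actA_one], fun h => by rw [h, actA_one]⟩

theorem actA_inv (σ : G) (a : A) : (P.actA σ a)⁻¹ = P.actA (P.actG a σ) a⁻¹ := by
  rw [inv_eq_iff_mul_eq_one]
  have h := P.actA_mul (P.actG a σ) a a⁻¹
  rw [mul_inv_cancel, actA_one, actG_inv_actG] at h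
  exact h.symm

theorem actG_inv (a : A) (σ : G) : (P.actG a σ)⁻¹ = P.actG (P.actA σ a) σ⁻¹ := P.swap.actA_inv a σ

/-- The action of the antipode on the indices of the basis. -/
def inv (i : A × G) : A × G := ((P.actA i.2 i.1)⁻¹, (P.actG i.1 i.2)⁻¹)

theorem inv_inv (i : A × G) : P.inv (P.inv i) = i := by
  obtain ⟨a, σ⟩ := i
  simp only [inv]
  refine Prod.ext ?_ ?_
  · change (P.actA (P.actG a σ)⁻¹ (P.actA σ a)⁻¹)⁻¹ = a
    rw [actA_inv P σ a, actA_inv_actA, _root_.inv_inv]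
  · change (P.actG (P.actA σ a)⁻¹ (P.actG a σ)⁻¹)⁻¹ = σ
    rw [actG_inv P a σ, actG_inv_actG, _root_.inv_inv]

theorem map_mul_of_basis {k H B I : Type*} [Field k] [Ring H] [Algebra k H] [Ring B] [Algebra k B]
    (b : Module.Basis I k H) (f : H →ₗ[k] B) (h : ∀ i j, f (b i * b j) = f (b i) * f (b j))
    (x y : H) : f (x * y) = f x * f y := by
  have : (LinearMap.mul k H).compr₂ f = (LinearMap.mul k B).compl₁₂ f f :=
    b.ext fun i => b.ext fun j => h i j
  exact LinearMap.congr_fun₂ this x y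

section Hopf

variable (k : Type*) [Field k] {H : Type*} [Ring H] [Algebra k H] [DecidableEq A] [Fintype A]

/-- The multiplication table of the bicrossproduct of a matched pair. -/
structure IsBicrossedBasis (b : A × G → H) : Prop where
  mul : ∀ a σ c τ, b (a, σ) * b (c, τ) = if a = P.actA τ c then b (c, σ * τ) else 0
  one : ∑ a, b (a, 1) = 1

variable {k} {P} {b : Module.Basis (A × G) k H}

/-- The comultiplication on the basis. -/
def comulOn (P : MatchedPair A G) (k : Type*) [Field k] {H : Type*} [Ring H] [Algebra k H]
    (b : A × G → H) (i : A × G) : H ⊗[k] H :=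
  ∑ c, b (i.1 * c⁻¹, P.actG c i.2) ⊗ₜ[k] b (c, i.2)

/-- For each `d` in the second leg only `x = P.actA τ d` survives. Then `actG_mul` merges the group
components, and `actA_mul` turns the condition on the first leg into one free of `d`. -/
theorem IsBicrossedBasis.comulOn_mul {b : A × G → H} (hb : P.IsBicrossedBasis b) (a c : A)
    (σ τ : G) : P.comulOn k b (a, σ) * P.comulOn k b (c, τ) =
      if a = P.actA τ c then P.comulOn k b (c, σ * τ) else 0 := by
  simp only [comulOn, Finset.sum_mul_sum, Algebra.TensorProduct.tmul_mul_tmul, hb.mul]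
  rw [Finset.sum_comm]
  have h : ∀ d, ∑ x, (if a * x⁻¹ = P.actA (P.actG d τ) (c * d⁻¹) then
      b (c * d⁻¹, P.actG x σ * P.actG d τ) else 0) ⊗ₜ[k]
      (if x = P.actA τ d then b (d, σ * τ) else 0) =
      if a = P.actA τ c then b (c * d⁻¹, P.actG d (σ * τ)) ⊗ₜ[k] b (d, σ * τ) else 0 := by
    intro d
    rw [Finset.sum_eq_single (P.actA τ d)]
    · rw [if_pos rfl, ← P.actG_mul]
      have : a * (P.actA τ d)⁻¹ = P.actA (P.actG d τ) (c * d⁻¹) ↔ a = P.actA τ c := by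
        rw [mul_inv_eq_iff_eq_mul, ← P.actA_mul, inv_mul_cancel_right]
      rw [if_congr this rfl rfl]
      split_ifs
      · rfl
      · rw [TensorProduct.zero_tmul]
    · intro x _ hx
      rw [if_neg hx, TensorProduct.tmul_zero]
    · simp
  rw [Finset.sum_congr rfl fun d _ => h d]
  split_ifs
  · rfl
  · simp

theorem IsBicrossedBasis.sum_comulOn_one {b : A × G → H} (hb : P.IsBicrossedBasis b) :
    ∑ a, P.comulOn k b (a, 1) = 1 := by
  simp only [comulOn, P.actG_one]
  rw [Finset.sum_comm]
  have h : ∀ c, ∑ a, b (a * c⁻¹, 1) ⊗ₜ[k] b (c, 1) = 1 ⊗ₜ[k] b (c, 1) := by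
    intro c
    rw [← TensorProduct.sum_tmul, ← hb.one]
    exact congrArg (· ⊗ₜ[k] b (c, 1)) (Equiv.sum_comp (Equiv.mulRight c⁻¹) fun a => b (a, 1))
  rw [Finset.sum_congr rfl fun c _ => h c, ← TensorProduct.tmul_sum, hb.one,
    Algebra.TensorProduct.one_def]

/-- An algebra with a basis multiplying like that of a bicrossproduct is a coalgebra. -/
@[reducible]
noncomputable def coalgebra (P : MatchedPair A G) (b : Module.Basis (A × G) k H) :
    Coalgebra k H where
  comul := b.constr k (P.comulOn k b)
  counit := b.constr k fun i => if i.1 = 1 then (1 : k) else 0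
  coassoc := by
    refine b.ext fun ⟨a, σ⟩ => ?_
    simp only [LinearMap.comp_apply, Module.Basis.constr_basis, comulOn, map_sum,
      LinearMap.rTensor_tmul, LinearMap.lTensor_tmul, LinearEquiv.coe_coe,
      TensorProduct.sum_tmul, TensorProduct.tmul_sum, TensorProduct.assoc_tmul]
    rw [Finset.sum_comm (s := (Finset.univ : Finset A)) (t := (Finset.univ : Finset A))]
    conv_rhs => rw [Finset.sum_comm]
    conv_lhs => rw [Finset.sum_comm]
    refine Finset.sum_congr rfl fun c _ => ?_
    rw [← Equiv.sum_comp (Equiv.mulRight c⁻¹)]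
    refine Finset.sum_congr rfl fun e _ => ?_
    simp only [Equiv.coe_mulRight, mul_inv_rev, _root_.inv_inv]
    rw [← P.mul_actG]
    simp [mul_assoc]
  rTensor_counit_comp_comul := by
    refine b.ext fun ⟨a, σ⟩ => ?_
    simp only [LinearMap.comp_apply, Module.Basis.constr_basis, comulOn, map_sum,
      LinearMap.rTensor_tmul, TensorProduct.mk_apply]
    rw [Finset.sum_eq_single a]
    · simp
    · intro c _ hc
      rw [if_neg (by simpa [mul_inv_eq_one] using Ne.symm hc), TensorProduct.zero_tmul]
    · simp
  lTensor_counit_comp_comul := by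
    refine b.ext fun ⟨a, σ⟩ => ?_
    simp only [LinearMap.comp_apply, Module.Basis.constr_basis, comulOn, map_sum,
      LinearMap.lTensor_tmul, LinearMap.flip_apply, TensorProduct.mk_apply]
    rw [Finset.sum_eq_single 1]
    · simp [P.one_actG]
    · intro c _ hc
      rw [if_neg hc, TensorProduct.tmul_zero]
    · simp

theorem comul_mul (hb : P.IsBicrossedBasis b) (x y : H) :
    b.constr k (P.comulOn k b) (x * y) =
    b.constr k (P.comulOn k b) x * b.constr k (P.comulOn k b) y := by
  refine map_mul_of_basis b _ (fun ⟨a, σ⟩ ⟨c, τ⟩ => ?_) x y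
  rw [hb.mul, apply_ite (b.constr k _), map_zero, b.constr_basis, b.constr_basis, b.constr_basis,
    hb.comulOn_mul]

theorem counit_mul (hb : P.IsBicrossedBasis b) (x y : H) :
    b.constr k (fun i => if i.1 = 1 then (1 : k) else 0) (x * y) =
    b.constr k (fun i => if i.1 = 1 then (1 : k) else 0) x *
      b.constr k (fun i => if i.1 = 1 then (1 : k) else 0) y := by
  refine map_mul_of_basis b _ (fun ⟨a, σ⟩ ⟨c, τ⟩ => ?_) x y
  rw [hb.mul, apply_ite (b.constr k _), map_zero, b.constr_basis, b.constr_basis, b.constr_basis]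
  by_cases hc : c = 1
  · simp [hc, P.actA_one]
  · simp [hc]

theorem comul_one (hb : P.IsBicrossedBasis b) :
    b.constr k (P.comulOn k b) 1 = 1 := by
  rw [← hb.sum_comulOn_one (k := k), ← hb.one, map_sum]
  simp only [Module.Basis.constr_basis]

theorem counit_one (hb : P.IsBicrossedBasis b) :
    b.constr k (fun i => if i.1 = 1 then (1 : k) else 0) 1 = 1 := by
  rw [← hb.one, map_sum]
  simp only [Module.Basis.constr_basis]
  simp

/-- An algebra with a basis multiplying like that of a bicrossproduct is a bialgebra. -/
@[reducible]
noncomputable def bialgebra (hb : P.IsBicrossedBasis b) : Bialgebra k H :=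
  letI := P.coalgebra b
  Bialgebra.mk' k H (counit_one hb) (counit_mul hb _ _) (comul_one hb) (comul_mul hb _ _)

/-- An algebra with a basis multiplying like that of a bicrossproduct is a Hopf algebra. -/
@[reducible]
noncomputable def hopfAlgebra (hb : P.IsBicrossedBasis b) : HopfAlgebra k H :=
  letI := bialgebra hb
  { antipode := b.constr k fun i => b (P.inv i)
    mul_antipode_rTensor_comul := by
      refine b.ext fun ⟨a, σ⟩ => ?_
      change LinearMap.mul' k H (LinearMap.rTensor H _ (b.constr k _ (b (a, σ)))) =
        algebraMap k H (b.constr k _ (b (a, σ)))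
      simp only [Module.Basis.constr_basis, comulOn, map_sum, LinearMap.rTensor_tmul,
        LinearMap.mul'_apply, inv, hb.mul]
      have h : ∀ c, (if (P.actA (P.actG c σ) (a * c⁻¹))⁻¹ = P.actA σ c then
          b (c, (P.actG (a * c⁻¹) (P.actG c σ))⁻¹ * σ) else 0) =
          if a = 1 then b (c, 1) else 0 := by
        intro c
        -- By `actA_mul` the two elements of `A` multiply to `P.actA σ a`, so the condition does not
        -- depend on `c`.
        have h1 : (P.actA (P.actG c σ) (a * c⁻¹))⁻¹ = P.actA σ c ↔ a = 1 := by
          rw [inv_eq_iff_mul_eq_one, ← P.actA_mul, inv_mul_cancel_right, P.actA_eq_one_iff]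
        rw [if_congr h1 rfl rfl, ← P.mul_actG, inv_mul_cancel_right]
        split_ifs with ha
        · rw [ha, P.one_actG, inv_mul_cancel]
        · rfl
      rw [Finset.sum_congr rfl fun c _ => h c]
      split_ifs with ha
      · rw [hb.one, map_one]
      · simp
    mul_antipode_lTensor_comul := by
      refine b.ext fun ⟨a, σ⟩ => ?_
      change LinearMap.mul' k H (LinearMap.lTensor H _ (b.constr k _ (b (a, σ)))) =
        algebraMap k H (b.constr k _ (b (a, σ)))
      simp only [Module.Basis.constr_basis, comulOn, map_sum, LinearMap.lTensor_tmul,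
        LinearMap.mul'_apply, inv, hb.mul]
      have h : ∀ c, (if a * c⁻¹ = P.actA (P.actG c σ)⁻¹ (P.actA σ c)⁻¹ then
          b ((P.actA σ c)⁻¹, P.actG c σ * (P.actG c σ)⁻¹) else 0) =
          if a = 1 then b ((P.actA σ c)⁻¹, 1) else 0 := by
        intro c
        have h1 : a * c⁻¹ = P.actA (P.actG c σ)⁻¹ (P.actA σ c)⁻¹ ↔ a = 1 := by
          rw [P.actA_inv, P.actA_inv_actA, mul_eq_right]
        rw [if_congr h1 rfl rfl, mul_inv_cancel]
      rw [Finset.sum_congr rfl fun c _ => h c]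
      split_ifs with ha
      · let e : A ≃ A := ⟨P.actA σ, P.actA σ⁻¹, P.actA_inv_actA σ, P.actA_actA_inv σ⟩
        rw [map_one, ← hb.one]
        exact Equiv.sum_comp (e.trans (Equiv.inv A)) fun a => b (a, 1)
      · simp }

theorem hopfAlgebra_counit (hb : P.IsBicrossedBasis b) (i : A × G) :
    letI := hopfAlgebra hb
    Coalgebra.counit (R := k) (b i) = if i.1 = 1 then (1 : k) else 0 :=
  b.constr_basis k _ i

theorem hopfAlgebra_comul (hb : P.IsBicrossedBasis b) (i : A × G) :
    letI := hopfAlgebra hb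
    Coalgebra.comul (R := k) (b i) = P.comulOn k b i :=
  b.constr_basis k _ i

theorem hopfAlgebra_antipode (hb : P.IsBicrossedBasis b) (i : A × G) :
    letI := hopfAlgebra hb
    HopfAlgebra.antipode k (b i) = b (P.inv i) :=
  b.constr_basis k _ i

end Hopf

end MatchedPair

/-! ### Structure constants and `Φ` on a bicrossproduct basis -/

section StructureConstants

variable {k : Type*} [Field k] {H : Type*} [Ring H] [HopfAlgebra k H]

theorem StructureConstantsIn.mono {I : Type*} {X Y : Set k} {b : Module.Basis I k H} (h : X ⊆ Y)
    (hb : StructureConstantsIn X b) : StructureConstantsIn Y b where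
  unit i := h (hb.unit i)
  counit i := h (hb.counit i)
  mul i j l := h (hb.mul i j l)
  comul i p := h (hb.comul i p)
  antipode i j := h (hb.antipode i j)

theorem StructureConstantsIn.isPositiveBasis {I : Type*} {b : Module.Basis I k H}
    (hb : StructureConstantsIn ({0, 1} : Set k) b) (σ : k →+* ℂ) : IsPositiveBasis σ b := by
  refine hb.mono ?_
  rintro c (rfl | rfl)
  · exact ⟨0, le_rfl, by simp⟩
  · exact ⟨1, zero_le_one, by simp⟩

theorem StructureConstantsIn.reindex {I J : Type*} {X : Set k} {b : Module.Basis I k H}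
    (hb : StructureConstantsIn X b) (e : I ≃ J) : StructureConstantsIn X (b.reindex e) where
  unit i := by simpa using hb.unit _
  counit i := by simpa using hb.counit _
  mul i j l := by simpa using hb.mul _ _ _
  comul i p := by
    have h : (b.reindex e).tensorProduct (b.reindex e) =
        (b.tensorProduct b).reindex (Equiv.prodCongr e e) := by
      ext ⟨i, j⟩
      simp [Module.Basis.tensorProduct_apply]
    rw [h, Module.Basis.repr_reindex_apply, Module.Basis.reindex_apply]
    exact hb.comul _ _
  antipode i j := by simpa using hb.antipode _ _

theorem IsPhiSetTheoretic.reindex {I J : Type*} {b : Module.Basis I k H}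
    (hb : IsPhiSetTheoretic b) (e : I ≃ J) : IsPhiSetTheoretic (b.reindex e) := by
  intro i j
  obtain ⟨p, q, h⟩ := hb (e.symm i) (e.symm j)
  exact ⟨e p, e q, by simpa using h⟩

variable {A G : Type*} [Group A] [Group G] [DecidableEq A] [Fintype A] {P : MatchedPair A G}
  {b : Module.Basis (A × G) k H}

theorem ite_mem_zero_one (p : Prop) [Decidable p] :
    (if p then (1 : k) else 0) ∈ ({0, 1} : Set k) := by
  split_ifs <;> simp

theorem basis_repr_mem_zero_one {I : Type*} (b : Module.Basis I k H) (i j : I) :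
    b.repr (b i) j ∈ ({0, 1} : Set k) := by
  classical
  rw [b.repr_self, Finsupp.single_apply]
  exact ite_mem_zero_one _

namespace MatchedPair.IsBicrossedBasis

theorem structureConstantsIn (hb : P.IsBicrossedBasis b)
    (hcounit : ∀ i, Coalgebra.counit (R := k) (b i) = if i.1 = 1 then (1 : k) else 0)
    (hcomul : ∀ i, Coalgebra.comul (R := k) (b i) = P.comulOn k b i)
    (hantipode : ∀ i, HopfAlgebra.antipode k (b i) = b (P.inv i)) :
    StructureConstantsIn ({0, 1} : Set k) b where
  unit := by
    classical
    rintro ⟨a, σ⟩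
    rw [← hb.one, map_sum, Finsupp.finsetSum_apply, Finset.sum_eq_single a]
    · exact basis_repr_mem_zero_one b _ _
    · intro c _ hc
      rw [b.repr_self, Finsupp.single_eq_of_ne]
      simp [Ne.symm hc]
    · simp
  counit i := by rw [hcounit]; exact ite_mem_zero_one _
  mul := by
    rintro ⟨a, σ⟩ ⟨c, τ⟩ l
    rw [hb.mul]
    split_ifs
    · exact basis_repr_mem_zero_one b _ _
    · simp
  comul := by
    classical
    rintro ⟨a, σ⟩ ⟨p, ⟨c, τ⟩⟩
    rw [hcomul, MatchedPair.comulOn, map_sum, Finsupp.finsetSum_apply, Finset.sum_eq_single c]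
    · rw [Module.Basis.tensorProduct_repr_tmul_apply, smul_eq_mul, b.repr_self, b.repr_self,
        Finsupp.single_apply, Finsupp.single_apply]
      split_ifs <;> simp
    · intro d _ hd
      rw [Module.Basis.tensorProduct_repr_tmul_apply, b.repr_self (d, σ), Finsupp.single_eq_of_ne]
      · simp
      · simp [Ne.symm hd]
    · simp
  antipode i j := by rw [hantipode]; exact basis_repr_mem_zero_one b _ _

theorem isPhiSetTheoretic (hb : P.IsBicrossedBasis b)
    (hcomul : ∀ i, Coalgebra.comul (R := k) (b i) = P.comulOn k b i) : IsPhiSetTheoretic b := by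
  rintro ⟨a, σ⟩ ⟨c, τ⟩
  -- The factor `b (c, τ)` annihilates every term of `Δ (b (a, σ))` but the one whose second leg has
  -- index `P.actA τ c`.
  refine ⟨(a * (P.actA τ c)⁻¹, P.actG (P.actA τ c) σ), (c, σ * τ), ?_⟩
  simp only [phi, LinearMap.comp_apply, LinearMap.rTensor_tmul, hcomul, MatchedPair.comulOn,
    TensorProduct.sum_tmul, map_sum, LinearEquiv.coe_coe, TensorProduct.assoc_tmul,
    LinearMap.lTensor_tmul, LinearMap.mul'_apply, hb.mul]
  rw [Finset.sum_eq_single (P.actA τ c)]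
  · rw [if_pos rfl]
  · intro d _ hd
    rw [if_neg hd, TensorProduct.tmul_zero]
  · simp

end MatchedPair.IsBicrossedBasis

end StructureConstants

/-! ### Bicrossproducts inside a given algebra -/

section Subalgebra

variable {k : Type v} [Field k] {T : Type u} [Ring T] [Algebra k T]

variable {A G : Type*} [Group A] [Group G] [DecidableEq A] [Fintype A]
  {P : MatchedPair A G} {B : A × G → T}

/-- A linearly independent family that multiplies like the basis of a bicrossproduct spans a
subalgebra that is a Hopf algebra. -/
theorem MatchedPair.IsBicrossedBasis.exists_hopfAlgebra (hB : P.IsBicrossedBasis B)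
    (hli : LinearIndependent k B) :
    ∃ (H : Type u) (_ : Ring H) (_ : HopfAlgebra k H) (ι : H →ₐ[k] T)
      (b : Module.Basis (A × G) k H), Function.Injective ι ∧ (∀ i, ι (b i) = B i) ∧
      (∀ i, Coalgebra.counit (R := k) (b i) = if i.1 = 1 then (1 : k) else 0) ∧
      (∀ i, Coalgebra.comul (R := k) (b i) = P.comulOn k b i) ∧
      (∀ i, HopfAlgebra.antipode k (b i) = b (P.inv i)) ∧
      StructureConstantsIn ({0, 1} : Set k) b ∧ IsPhiSetTheoretic b := by
  have hone : (1 : T) ∈ Submodule.span k (Set.range B) := by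
    rw [← hB.one]
    exact Submodule.sum_mem _ fun a _ => Submodule.subset_span ⟨(a, 1), rfl⟩
  have hmul : ∀ x y, x ∈ Submodule.span k (Set.range B) → y ∈ Submodule.span k (Set.range B) →
      x * y ∈ Submodule.span k (Set.range B) := by
    intro x y hx hy
    have h := Submodule.mul_mem_mul hx hy
    rw [Submodule.span_mul_span] at h
    refine Submodule.span_le.2 ?_ h
    rintro _ ⟨_, ⟨⟨a, σ⟩, rfl⟩, _, ⟨⟨c, τ⟩, rfl⟩, rfl⟩
    simp only [hB.mul]
    split_ifs
    · exact Submodule.subset_span ⟨_, rfl⟩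
    · exact Submodule.zero_mem _
  let W : Subalgebra k T := (Submodule.span k (Set.range B)).toSubalgebra hone hmul
  let b : Module.Basis (A × G) k W := Module.Basis.span hli
  have hbB : ∀ i, (b i : T) = B i := fun i => congrArg Subtype.val (Module.Basis.span_apply hli i)
  have hb : P.IsBicrossedBasis b :=
    { mul := by
        intro a σ c τ
        apply Subtype.val_injective
        rw [apply_ite (Subtype.val : W → T)]
        change (b (a, σ) : T) * (b (c, τ) : T) = if _ then (b _ : T) else 0
        rw [hbB, hbB, hbB, hB.mul]
      one := by
        apply Subtype.val_injective
        change W.val (∑ a, b (a, 1)) = 1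
        rw [map_sum, ← hB.one]
        exact Finset.sum_congr rfl fun a _ => hbB _ }
  let _ := MatchedPair.hopfAlgebra hb
  have h1 := MatchedPair.hopfAlgebra_counit hb
  have h2 := MatchedPair.hopfAlgebra_comul hb
  have h3 := MatchedPair.hopfAlgebra_antipode hb
  exact ⟨W, inferInstance, MatchedPair.hopfAlgebra hb, W.val, b, Subtype.val_injective, hbB, h1, h2,
    h3, hb.structureConstantsIn h1 h2 h3, hb.isPhiSetTheoretic h2⟩

end Subalgebra

/-! ### Solutions in terms of two groups acting on `S` -/

/-- The data from which a bijective solution is built: two groups acting on `S`, acting on each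
other, and two maps `π : S → A` and `ρ : S → G` with `s (x, y) = (π y • x, ρ x • y)`. -/
structure MatchedSolution {S : Type*} (A G : Type*) [Group A] [Group G] [MulAction A S]
    [MulAction G S] (s : S × S → S × S) where
  π : S → A
  ρ : S → G
  π_surjective : Function.Surjective π
  ρ_surjective : Function.Surjective ρ
  /-- The action of `A` on `G`. -/
  actG : A → G → G
  /-- The action of `G` on `A`. -/
  actA : G → A → A
  apply : ∀ x y, s (x, y) = (π y • x, ρ x • y)
  ρ_smul : ∀ a x, ρ (a • x) = actG a (ρ x)
  π_smul : ∀ (σ : G) y, π (σ • y) = actA σ (π y)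
  ρ_smul' : ∀ (σ : G) y, ρ (σ • y) = σ * ρ y
  π_smul' : ∀ (a : A) y, π (a • y) = π y * (actA (ρ y) a)⁻¹
  smul_smul : ∀ (a : A) (σ : G) y, a • σ • y = actG (actA (ρ y) a) σ • a • y

namespace MatchedSolution

variable {S A G : Type*} [Group A] [Group G] [MulAction A S] [MulAction G S] {s : S × S → S × S}
  (M : MatchedSolution A G s)

/-- The matched pair of groups of a matched solution. -/
def pair : MatchedPair A G where
  actG := M.actG
  actA := M.actA
  one_actG σ := by
    obtain ⟨x, rfl⟩ := M.ρ_surjective σ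
    rw [← M.ρ_smul, one_smul]
  mul_actG a b σ := by
    obtain ⟨x, rfl⟩ := M.ρ_surjective σ
    rw [← M.ρ_smul, ← M.ρ_smul, ← M.ρ_smul, mul_smul]
  one_actA a := by
    obtain ⟨x, rfl⟩ := M.π_surjective a
    rw [← M.π_smul, one_smul]
  mul_actA σ τ a := by
    obtain ⟨x, rfl⟩ := M.π_surjective a
    rw [← M.π_smul, ← M.π_smul, ← M.π_smul, mul_smul]
  -- Compute `π ((a * b) • y)` at once and in two steps, for `y` with `ρ y = σ`.
  actA_mul σ a b := by
    obtain ⟨y, rfl⟩ := M.ρ_surjective σ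
    have h := M.π_smul' (a * b) y
    rw [mul_smul, M.π_smul', M.π_smul', mul_assoc, mul_right_inj, ← mul_inv_rev, inv_inj,
      M.ρ_smul] at h
    exact h.symm
  actG_mul a σ τ := by
    obtain ⟨y, rfl⟩ := M.ρ_surjective τ
    rw [← M.ρ_smul', ← M.ρ_smul, M.smul_smul, M.ρ_smul', M.ρ_smul]

theorem pair_actG (a : A) (σ : G) : M.pair.actG a σ = M.actG a σ := rfl

theorem pair_actA (σ : G) (a : A) : M.pair.actA σ a = M.actA σ a := rfl

/-- Freeness of the actions is what later yields linear independence. -/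
theorem smul_right_cancel (M : MatchedSolution A G s) {σ τ : G} {y : S} (h : σ • y = τ • y) :
    σ = τ := by
  have := congrArg M.ρ h
  rwa [M.ρ_smul', M.ρ_smul', mul_left_inj] at this

theorem smul_right_cancel' (M : MatchedSolution A G s) {a b : A} {y : S} (h : a • y = b • y) :
    a = b := by
  have := congrArg M.π h
  rw [M.π_smul', M.π_smul', mul_right_inj, inv_inj] at this
  rw [← M.pair.actA_inv_actA (M.ρ y) a, M.pair_actA _ a, this, ← M.pair_actA _ b,
    M.pair.actA_inv_actA]

end MatchedSolution

/-! ### The matched solution attached to `s` -/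

section OfSolution

/-- Since `e ∘ x` and `x` have the same right translation, this makes the action of `A` on `G`
independent of representatives. -/
theorem rho_psiPerm_rho {S : Type u} [Finite S] {s : Equiv.Perm (S × S)} (hs : IsRPESolution s)
    {e : S} (he : rho hs e = 1) (z x : S) :
    rho hs (psiPerm hs z (rho hs x e)) = rho hs (psiPerm hs z x) := by
  have h := psiPerm_rho hs x e z
  rw [h, he, rho_rho, show rho hs (psiPerm hs z e) = 1 from rho_psi_eq_one hs he z, mul_one]
  rfl

variable {S : Type u} [Finite S] [Nonempty S] {s : Equiv.Perm (S × S)} (hs : IsRPESolution s)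

/-- The group of the permutations `ψ_z`. -/
def psiGroup : Subgroup (Equiv.Perm S) where
  carrier := Set.range (psiPerm hs)
  one_mem' := by
    obtain ⟨e, -, h⟩ := exists_idempotent_psiPerm_eq_one hs
    exact ⟨e, h⟩
  inv_mem' := by
    rintro _ ⟨z, rfl⟩
    obtain ⟨e, he, h⟩ := exists_idempotent_psiPerm_eq_one hs
    exact ⟨psiPerm hs z e, by rw [psiPerm_psiPerm_idempotent hs he, h, one_mul]⟩
  mul_mem' := by
    rintro _ _ ⟨y, rfl⟩ ⟨z, rfl⟩
    obtain ⟨e, he, h⟩ := exists_idempotent_psiPerm_eq_one hs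
    obtain ⟨f, hf, hfy⟩ := exists_idempotent_psiPerm_eq hs y
    -- The permutation attached to `ψ_z e` is `ψ_z⁻¹`; applying it to `f` gives an element with
    -- permutation `ψ_f (ψ_z⁻¹)⁻¹ = ψ_y ψ_z`.
    refine ⟨psiPerm hs (psiPerm hs z e) f, ?_⟩
    rw [psiPerm_psiPerm_idempotent hs hf, psiPerm_psiPerm_idempotent hs he, h, one_mul, inv_inv,
      hfy]

/-- The group of the right translations of `(S, ∘)`. -/
def rhoGroup : Subgroup (Equiv.Perm S) where
  carrier := Set.range (rho hs)
  one_mem' := by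
    obtain ⟨e, h, -⟩ := exists_idempotent_psiPerm_eq_one hs
    exact ⟨e, h⟩
  inv_mem' := by
    rintro _ ⟨z, rfl⟩
    exact exists_rho_eq_inv hs z
  mul_mem' := by
    rintro _ _ ⟨x, rfl⟩ ⟨y, rfl⟩
    exact ⟨rho hs x y, rho_rho hs x y⟩

/-- Every bijective solution on a finite set comes from a matched pair of groups. -/
theorem nonempty_matchedSolution :
    Nonempty (MatchedSolution (psiGroup hs) (rhoGroup hs) s) := by
  obtain ⟨e, he, -⟩ := exists_idempotent_psiPerm_eq_one hs
  let π : S → psiGroup hs := fun y => ⟨psiPerm hs y, y, rfl⟩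
  let ρ : S → rhoGroup hs := fun x => ⟨rho hs x, x, rfl⟩
  have hρe : ∀ σ : rhoGroup hs, ρ (σ • e) = σ := by
    rintro ⟨_, x, rfl⟩
    apply Subtype.ext
    change rho hs (rho hs x e) = rho hs x
    rw [rho_rho, he, mul_one]
  have hππ : ∀ (a : psiGroup hs) y z, (a : Equiv.Perm S) = psiPerm hs z →
      π (a • y) = π y * (π (ρ y • z))⁻¹ := by
    rintro ⟨_, -⟩ y z rfl
    exact Subtype.ext (psiPerm_psiPerm hs y z)
  exact ⟨
    { π := π
      ρ := ρ
      π_surjective := by rintro ⟨_, y, rfl⟩; exact ⟨y, rfl⟩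
      ρ_surjective := by rintro ⟨_, y, rfl⟩; exact ⟨y, rfl⟩
      -- The map `σ ↦ σ • e` is a section of `ρ`. Both formulas are forced: they are `ρ_smul` and
      -- `π_smul'` at the point `σ • e`.
      actG := fun a σ => ρ (a • σ • e)
      actA := fun σ a => (π (a • σ • e))⁻¹ * π (σ • e)
      apply := fun x y => rfl
      ρ_smul := by
        rintro ⟨_, z, rfl⟩ x
        exact Subtype.ext (rho_psiPerm_rho hs he z x).symm
      π_smul := by
        intro σ z
        rw [hππ (π z) (σ • e) z rfl, hρe]
        group
      ρ_smul' := by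
        rintro ⟨_, x, rfl⟩ y
        exact Subtype.ext (rho_rho hs x y)
      π_smul' := by
        rintro ⟨_, z, rfl⟩ y
        rw [hππ _ y z rfl, hππ _ (ρ y • e) z rfl, hρe]
        group
      smul_smul := by
        rintro ⟨_, z, rfl⟩ ⟨_, x, rfl⟩ y
        have h : (π (psiPerm hs z (rho hs y e)))⁻¹ * π (rho hs y e) = π (rho hs y z) := by
          have h1 := hππ ⟨_, z, rfl⟩ (ρ y • e) z rfl
          rw [hρe] at h1
          change (π ((⟨_, z, rfl⟩ : psiGroup hs) • ρ y • e))⁻¹ * π (ρ y • e) = π (ρ y • z)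
          rw [h1]
          group
        change psiPerm hs z (rho hs x y) = (ρ (((π (psiPerm hs z (rho hs y e)))⁻¹ *
          π (rho hs y e)) • rho hs x e)) • psiPerm hs z y
        rw [h]
        change _ = rho hs (psiPerm hs (rho hs y z) (rho hs x e)) (psiPerm hs z y)
        rw [rho_psiPerm_rho hs he, psiPerm_rho] }⟩

end OfSolution

/-! ### Matrices of partial maps -/

section PartialMaps

variable (k : Type v) [Field k] {S : Type u} [Fintype S] [DecidableEq S]

/-- The matrix of the partial map `f` with domain `p`. -/
def partialMatrix (p : S → Prop) [DecidablePred p] (f : S → S) : Matrix S S k :=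
  ∑ y ∈ Finset.univ.filter p, Matrix.single (f y) y (1 : k)

theorem partialMatrix_apply (p : S → Prop) [DecidablePred p] (f : S → S) (i j : S) :
    partialMatrix k p f i j = if p j ∧ f j = i then 1 else 0 := by
  rw [partialMatrix, Matrix.sum_apply, Finset.sum_filter, Finset.sum_eq_single j]
  · simp only [Matrix.single_apply, and_true]
    rw [ite_and]
  · intro y _ hy
    simp [hy]
  · simp

theorem partialMatrix_mul (p q : S → Prop) [DecidablePred p] [DecidablePred q] (f g : S → S) :
    partialMatrix k p f * partialMatrix k q g =
      partialMatrix k (fun y => q y ∧ p (g y)) (f ∘ g) := by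
  ext i j
  rw [Matrix.mul_apply, Finset.sum_eq_single (g j)]
  · simp only [partialMatrix_apply, Function.comp_apply, and_true]
    by_cases hq : q j <;> simp [hq]
  · intro y _ hy
    simp [partialMatrix_apply, Ne.symm hy]
  · simp

theorem partialMatrix_congr {p q : S → Prop} [DecidablePred p] [DecidablePred q] {f g : S → S}
    (hpq : ∀ y, p y ↔ q y) (hfg : ∀ y, p y → f y = g y) :
    partialMatrix k p f = partialMatrix k q g := by
  ext i j
  rw [partialMatrix_apply, partialMatrix_apply]
  refine if_congr ?_ rfl rfl
  rw [← hpq]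
  exact and_congr_right fun h => by rw [hfg j h]

theorem partialMatrix_eq_zero {p : S → Prop} [DecidablePred p] (f : S → S) (hp : ∀ y, ¬ p y) :
    partialMatrix k p f = 0 := by
  ext i j
  simp [partialMatrix_apply, hp]

theorem sum_partialMatrix_id {I : Type*} [Fintype I] [DecidableEq I] (c : S → I) :
    ∑ i, partialMatrix k (fun y => c y = i) id = 1 := by
  ext i j
  simp only [Matrix.sum_apply, partialMatrix_apply, Matrix.one_apply, id, ite_and]
  simp [eq_comm]

/-- The element of `A ⊗ A` of the partial map `f` of `S × S` with domain `p`. -/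
noncomputable def partialTensor (p : S × S → Prop) [DecidablePred p] (f : S × S → S × S) :
    Matrix S S k ⊗[k] Matrix S S k :=
  ∑ q : S × S, if p q then
    Matrix.single (f q).1 q.1 (1 : k) ⊗ₜ[k] Matrix.single (f q).2 q.2 (1 : k) else 0

theorem partialTensor_true (s : S × S → S × S) :
    partialTensor k (fun _ => True) s = tensorOf k s := by
  simp [partialTensor, tensorOf]

theorem partialTensor_mul (p q : S × S → Prop) [DecidablePred p] [DecidablePred q]
    (f g : S × S → S × S) :
    partialTensor k p f * partialTensor k q g =
      partialTensor k (fun x => q x ∧ p (g x)) (f ∘ g) := by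
  unfold partialTensor
  rw [Finset.sum_mul_sum, Finset.sum_comm]
  refine Finset.sum_congr rfl fun x _ => ?_
  by_cases hq : q x
  · rw [Finset.sum_eq_single (g x)]
    · by_cases hp : p (g x) <;> simp [hq, hp]
    · intro y _ hy
      rw [if_pos hq, ite_mul, zero_mul, Algebra.TensorProduct.tmul_mul_tmul]
      by_cases h1 : y.1 = (g x).1
      · have h2 : y.2 ≠ (g x).2 := fun h2 => hy (Prod.ext h1 h2)
        rw [Matrix.single_mul_single_of_ne _ _ _ _ h2, TensorProduct.tmul_zero, ite_self]
      · rw [Matrix.single_mul_single_of_ne _ _ _ _ h1, TensorProduct.zero_tmul, ite_self]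
    · simp
  · simp [hq]

theorem partialMatrix_tmul (p q : S → Prop) [DecidablePred p] [DecidablePred q] (f g : S → S) :
    partialMatrix k p f ⊗ₜ[k] partialMatrix k q g =
      partialTensor k (fun x => p x.1 ∧ q x.2) (fun x => (f x.1, g x.2)) := by
  unfold partialMatrix partialTensor
  rw [TensorProduct.sum_tmul, Fintype.sum_prod_type, Finset.sum_filter]
  refine Finset.sum_congr rfl fun x _ => ?_
  by_cases hp : p x
  · simp [hp, TensorProduct.tmul_sum, Finset.sum_filter,
      apply_ite (Matrix.single (f x) x (1 : k) ⊗ₜ[k] ·)]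
  · simp [hp]

theorem one_eq_partialMatrix : (1 : Matrix S S k) = partialMatrix k (fun _ => True) id := by
  ext i j
  simp [partialMatrix_apply, Matrix.one_apply, eq_comm]

theorem sum_partialTensor {I : Type*} [Fintype I] [DecidableEq I] (p : I → S × S → Prop)
    [∀ i, DecidablePred (p i)] (q : S × S → Prop) [DecidablePred q] (f : I → S × S → S × S)
    (g : S × S → S × S) (c : S × S → I) (hp : ∀ i y, p i y ↔ i = c y ∧ q y)
    (hf : ∀ y, q y → f (c y) y = g y) :
    ∑ i, partialTensor k (p i) (f i) = partialTensor k q g := by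
  unfold partialTensor
  rw [Finset.sum_comm]
  refine Finset.sum_congr rfl fun y _ => ?_
  rw [Finset.sum_eq_single (c y)]
  · by_cases hq : q y
    · rw [if_pos ((hp _ _).2 ⟨rfl, hq⟩), if_pos hq, hf y hq]
    · rw [if_neg fun h => hq ((hp _ _).1 h).2, if_neg hq]
  · intro i _ hi
    rw [if_neg fun h => hi ((hp _ _).1 h).1]
  · simp

end PartialMaps

/-! ### The two families of matrices and the factorisation of `R` -/

namespace MatchedSolution

variable (k : Type v) [Field k] {S : Type u} [Fintype S] [DecidableEq S]
  {A G : Type*} [Group A] [Group G]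
  [MulAction A S] [MulAction G S] {s : Equiv.Perm (S × S)} (M : MatchedSolution A G s)

/-- The basis of `H_r(s)`. -/
def right [DecidableEq A] (i : A × G) : Matrix S S k :=
  partialMatrix k (fun y => M.π y = i.1) (i.2 • ·)

/-- The basis of `H_ℓ(s)`. -/
def left [DecidableEq G] (i : A × G) : Matrix S S k :=
  partialMatrix k (fun x => M.ρ x = i.2) (i.1 • ·)

theorem right_isBicrossedBasis [Fintype A] [DecidableEq A] :
    M.pair.IsBicrossedBasis (M.right k) where
  mul a σ c τ := by
    rw [right, right, partialMatrix_mul]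
    split_ifs with h
    · refine partialMatrix_congr k (fun y => ?_) fun y _ => (mul_smul σ τ y).symm
      dsimp only
      rw [M.π_smul, h]
      exact and_iff_left_of_imp fun h' => by rw [h']; rfl
    · refine partialMatrix_eq_zero k _ fun y => ?_
      rintro ⟨rfl, h2⟩
      dsimp only at h2
      rw [M.π_smul] at h2
      exact h h2.symm
  one := by
    simp only [right, one_smul]
    exact sum_partialMatrix_id k M.π

/-- Here `G` indexes the domains and `A` acts, so the two groups exchange roles. -/
theorem left_isBicrossedBasis [Fintype G] [DecidableEq G] :
    M.pair.swap.IsBicrossedBasis (M.left k ∘ Prod.swap) where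
  mul σ a τ c := by
    change M.left k (a, σ) * M.left k (c, τ) = if σ = M.actG c τ then M.left k (a * c, τ) else 0
    rw [left, left, partialMatrix_mul]
    split_ifs with h
    · refine partialMatrix_congr k (fun y => ?_) fun y _ => (mul_smul a c y).symm
      dsimp only
      rw [M.ρ_smul, h]
      exact and_iff_left_of_imp fun h' => by rw [h']
    · refine partialMatrix_eq_zero k _ fun y => ?_
      rintro ⟨rfl, h2⟩
      dsimp only at h2
      rw [M.ρ_smul] at h2
      exact h h2.symm
  one := by
    simp only [left, Function.comp_apply, Prod.swap_prod_mk, one_smul]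
    exact sum_partialMatrix_id k M.ρ

/-- The functional that reads off the coordinate `i` with respect to `M.right`. -/
noncomputable def rightCoord (i : A × G) : Module.Dual k (Matrix S S k) :=
  Matrix.entryLinearMap k k (i.2 • (M.π_surjective i.1).choose) (M.π_surjective i.1).choose

/-- At a point `y` with `π y = i.1`, freeness lets only one `σ` satisfy `σ • y = i.2 • y`. -/
theorem rightCoord_right [DecidableEq A] [DecidableEq G] (i j : A × G) :
    M.rightCoord k i (M.right k j) = if i = j then 1 else 0 := by
  rw [rightCoord, Matrix.entryLinearMap_apply, right, partialMatrix_apply,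
    (M.π_surjective i.1).choose_spec]
  refine if_congr ⟨fun h => Prod.ext h.1 (M.smul_right_cancel h.2).symm, ?_⟩ rfl rfl
  rintro rfl
  exact ⟨rfl, rfl⟩

/-- The functional that reads off the coordinate `i` with respect to `M.left`. -/
noncomputable def leftCoord (i : A × G) : Module.Dual k (Matrix S S k) :=
  Matrix.entryLinearMap k k (i.1 • (M.ρ_surjective i.2).choose) (M.ρ_surjective i.2).choose

theorem leftCoord_left [DecidableEq A] [DecidableEq G] (i j : A × G) :
    M.leftCoord k i (M.left k j) = if i = j then 1 else 0 := by
  rw [leftCoord, Matrix.entryLinearMap_apply, left, partialMatrix_apply,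
    (M.ρ_surjective i.2).choose_spec]
  refine if_congr ⟨fun h => Prod.ext (M.smul_right_cancel' h.2).symm h.1, ?_⟩ rfl rfl
  rintro rfl
  exact ⟨rfl, rfl⟩

theorem tensorOf_eq_sum [Fintype A] [DecidableEq A] [Fintype G] [DecidableEq G] :
    tensorOf k s = ∑ i, M.left k i ⊗ₜ[k] M.right k i := by
  simp only [left, right, partialMatrix_tmul]
  rw [← partialTensor_true]
  exact (sum_partialTensor k _ _ _ _ (fun q : S × S => (M.π q.2, M.ρ q.1))
    (fun i y => by simp only [Prod.ext_iff, and_true]; tauto)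
    fun y _ => (M.apply y.1 y.2).symm).symm

/-- This is `R⁻¹ = (1 ⊗ 𝒮)(R)`, where `𝒮` is the antipode, expressed through its action on indices.
-/
theorem tensorOf_symm_eq_sum [Fintype A] [DecidableEq A] [Fintype G] [DecidableEq G] :
    tensorOf k s.symm = ∑ i, M.left k i ⊗ₜ[k] M.right k (M.pair.inv i) := by
  simp only [left, right, partialMatrix_tmul]
  rw [← partialTensor_true]
  have key : ∀ u v a, M.π v = (M.pair.actA (M.ρ u) a)⁻¹ ↔ a = M.pair.actA (M.ρ u)⁻¹ (M.π v)⁻¹ := by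
    intro u v a
    constructor
    · intro h
      rw [h, inv_inv, M.pair.actA_inv_actA]
    · intro h
      rw [h, M.pair.actA_actA_inv, inv_inv]
  -- The piece containing `(u, v)` has `σ = ρ u`, and its `a` is the solution of `π v = (M.pair.actA
  -- (ρ u) a)⁻¹`.
  refine (sum_partialTensor k _ _ _ _
    (fun q : S × S => (M.pair.actA (M.ρ q.1)⁻¹ (M.π q.2)⁻¹, M.ρ q.1)) ?_ ?_).symm
  · rintro ⟨a, σ⟩ ⟨u, v⟩
    simp only [MatchedPair.inv, Prod.mk.injEq, and_true]
    constructor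
    · rintro ⟨rfl, h⟩
      exact ⟨(key u v a).1 h, rfl⟩
    · rintro ⟨h, rfl⟩
      exact ⟨rfl, (key u v a).2 h⟩
  · rintro ⟨u, v⟩ -
    rw [Equiv.eq_symm_apply]
    obtain ⟨a, ha⟩ : ∃ a, a = M.pair.actA (M.ρ u)⁻¹ (M.π v)⁻¹ := ⟨_, rfl⟩
    have hv := (key u v a).2 ha
    simp only [← ha, MatchedPair.inv]
    rw [M.apply, M.ρ_smul, M.π_smul, hv, M.pair.actA_inv]
    have h1 : M.actA (M.pair.actG a (M.ρ u))⁻¹ (M.pair.actA (M.pair.actG a (M.ρ u)) a⁻¹) = a⁻¹ :=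
      M.pair.actA_inv_actA _ _
    rw [h1, inv_smul_smul, M.pair_actG, smul_inv_smul]

theorem tensorOf_symm_eq_sum' [Fintype A] [DecidableEq A] [Fintype G] [DecidableEq G] :
    tensorOf k s.symm = ∑ i, M.left k (M.pair.inv i) ⊗ₜ[k] M.right k i := by
  let e : A × G ≃ A × G := ⟨M.pair.inv, M.pair.inv, M.pair.inv_inv, M.pair.inv_inv⟩
  rw [M.tensorOf_symm_eq_sum k, ← Equiv.sum_comp e]
  refine Finset.sum_congr rfl fun i _ => ?_
  change M.left k (M.pair.inv i) ⊗ₜ[k] M.right k (M.pair.inv (M.pair.inv i)) = _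
  rw [M.pair.inv_inv]

/-- The terms on the left cut the domain of the partial map on the right by the value of `π` at the
second coordinate of `s (x, y)`; on each piece the maps agree by `smul_smul`. -/
theorem comulOn_right_mul [Fintype A] [DecidableEq A] (i : A × G) :
    M.pair.comulOn k (M.right k) i * tensorOf k s = tensorOf k s * (M.right k i ⊗ₜ[k] 1) := by
  obtain ⟨a, σ⟩ := i
  simp only [MatchedPair.comulOn, right, one_eq_partialMatrix k (S := S), partialMatrix_tmul,
    ← partialTensor_true, partialTensor_mul, Finset.sum_mul]
  have hπ : ∀ x y : S, M.π (M.π y • x) = M.π x * (M.π (M.ρ x • y))⁻¹ := by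
    intro x y
    rw [M.π_smul', M.π_smul]
  refine sum_partialTensor k _ _ _ _ (fun q => M.π (s q).2) ?_ ?_
  · rintro c ⟨x, y⟩
    simp only [M.apply, true_and, and_true]
    rw [hπ]
    constructor
    · rintro ⟨h, rfl⟩
      exact ⟨rfl, mul_right_cancel h⟩
    · rintro ⟨rfl, rfl⟩
      exact ⟨rfl, rfl⟩
  · rintro ⟨x, y⟩ -
    simp only [Function.comp_apply, M.apply, id]
    rw [M.ρ_smul', mul_smul, M.smul_smul, M.pair_actG, M.π_smul]

theorem mul_comulOn_left [Fintype G] [DecidableEq G] (i : G × A) :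
    tensorOf k s * M.pair.swap.comulOn k (M.left k ∘ Prod.swap) i =
      (1 ⊗ₜ[k] (M.left k ∘ Prod.swap) i) * tensorOf k s := by
  obtain ⟨σ, a⟩ := i
  simp only [MatchedPair.comulOn, left, one_eq_partialMatrix k (S := S), partialMatrix_tmul,
    ← partialTensor_true, partialTensor_mul, Finset.mul_sum, Function.comp_apply,
    Prod.swap_prod_mk]
  refine sum_partialTensor k _ _ _ _ (fun q => M.ρ q.2) ?_ ?_
  · rintro h ⟨x, y⟩
    simp only [M.apply, true_and, and_true]
    rw [M.ρ_smul']
    constructor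
    · rintro ⟨h1, rfl⟩
      exact ⟨rfl, by rw [h1, inv_mul_cancel_right]⟩
    · rintro ⟨rfl, rfl⟩
      exact ⟨(mul_inv_cancel_right _ _).symm, rfl⟩
  · rintro ⟨x, y⟩ -
    simp only [Function.comp_apply, M.apply, id]
    have h1 : M.pair.swap.actG (M.ρ y) a = M.actA (M.ρ y) a := rfl
    rw [h1, M.π_smul', M.ρ_smul, ← mul_smul, inv_mul_cancel_right, M.smul_smul]

end MatchedSolution

/-! ### Slices of a tensor along dual families -/

section Slices

variable {k : Type v} [Field k] {S : Type u}

theorem sliceRight_sum {I : Type*} [Fintype I] (C B : I → Matrix S S k)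
    (f : Module.Dual k (Matrix S S k)) :
    sliceRight (∑ i, C i ⊗ₜ[k] B i) f = ∑ i, f (C i) • B i := by
  simp [sliceRight]

theorem sliceLeft_sum {I : Type*} [Fintype I] (C B : I → Matrix S S k)
    (f : Module.Dual k (Matrix S S k)) :
    sliceLeft (∑ i, C i ⊗ₜ[k] B i) f = ∑ i, f (B i) • C i := by
  simp [sliceLeft]

end Slices

section DualFamilies

variable {k T H I : Type*} [Field k] [Ring T] [Algebra k T] [Ring H] [Algebra k H] [Fintype I]

theorem linearIndependent_of_coord [DecidableEq I] {B : I → T} (c : I → Module.Dual k T)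
    (hc : ∀ i j, c i (B j) = if i = j then 1 else 0) : LinearIndependent k B := by
  rw [Fintype.linearIndependent_iff]
  intro g hg i
  have h := congrArg (c i) hg
  simpa [map_sum, hc] using h

variable {ι : H →ₐ[k] T} {b : Module.Basis I k H} {B C : I → T}

theorem map_sum_smul_basis (hb : ∀ i, ι (b i) = B i) (r : I → k) :
    ι (∑ i, r i • b i) = ∑ i, r i • B i := by
  simp [hb]

/-- Functionals dual to `C` realise every coefficient vector, so the slices fill the whole span of
`B`. -/
theorem range_eq_range_sum [DecidableEq I] (hb : ∀ i, ι (b i) = B i) (c : I → Module.Dual k T)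
    (hc : ∀ i j, c i (C j) = if i = j then 1 else 0) :
    Set.range ι = Set.range fun f : Module.Dual k T => ∑ i, f (C i) • B i := by
  ext x
  constructor
  · rintro ⟨h, rfl⟩
    refine ⟨∑ i, b.repr h i • c i, ?_⟩
    conv_rhs => rw [← b.sum_repr h, map_sum_smul_basis hb]
    simp [hc]
  · rintro ⟨f, rfl⟩
    exact ⟨_, map_sum_smul_basis hb _⟩

theorem eq_sum_of_map_eq (hι : Function.Injective ι) (hb : ∀ i, ι (b i) = B i) {h : H}
    {f : Module.Dual k T} (hf : ι h = ∑ i, f (C i) • B i) : h = ∑ i, f (C i) • b i :=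
  hι (by rw [hf, map_sum_smul_basis hb])

end DualFamilies

theorem MatchedPair.map_comulOn {A G : Type*} [Group A] [Group G] [Fintype A]
    (P : MatchedPair A G) {k T H : Type*} [Field k] [Ring T] [Algebra k T] [Ring H] [Algebra k H]
    {ι : H →ₐ[k] T} {b : A × G → H} {B : A × G → T} (hb : ∀ i, ι (b i) = B i) (i : A × G) :
    TensorProduct.map ι.toLinearMap ι.toLinearMap (P.comulOn k b i) = P.comulOn k B i := by
  simp [MatchedPair.comulOn, hb]

/-! ### The coefficient Hopf algebras and the indexing of their bases -/

namespace MatchedSolution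

variable (k : Type v) [Field k] {S : Type u}
  {A G : Type*} [Group A] [Group G] [MulAction A S] [MulAction G S] {s : Equiv.Perm (S × S)}

section HopfAlgebras

variable [Fintype S] [DecidableEq S] [Fintype A] [DecidableEq A] [Fintype G] [DecidableEq G]
  (M : MatchedSolution A G s)

theorem exists_rightCoefficientHopfAlgebra :
    ∃ (H : Type (max u v)) (_ : Ring H) (_ : HopfAlgebra k H) (ι : H →ₐ[k] Matrix S S k),
      IsRightCoefficientHopfAlgebra s ι ∧ ∃ b : Module.Basis (A × G) k H,
        (∀ i, ι (b i) = M.right k i) ∧ StructureConstantsIn ({0, 1} : Set k) b ∧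
        IsPhiSetTheoretic b := by
  obtain ⟨H, _, _, ι, b, hι, hb, hcounit, hcomul, hantipode, hsc, hphi⟩ :=
    (M.right_isBicrossedBasis k).exists_hopfAlgebra
      (linearIndependent_of_coord _ (M.rightCoord_right k))
  have hval : ∀ f, sliceRight (algSolution k s).val f = ∑ i, f (M.left k i) • M.right k i := by
    intro f
    rw [← sliceRight_sum, ← M.tensorOf_eq_sum k]; rfl
  refine ⟨H, _, _, ι, ⟨hι, ?_, ?_, ?_, ?_⟩, b, hb, hsc, hphi⟩
  · rw [range_eq_range_sum hb (M.leftCoord k) (M.leftCoord_left k)]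
    exact congrArg Set.range (funext fun f => (hval f).symm)
  · intro h f hf
    rw [hval] at hf
    -- The counit keeps the terms with `i.1 = 1`, and their left factors add up to 1.
    rw [eq_sum_of_map_eq hι hb hf, ← (M.left_isBicrossedBasis k).one]
    simp [hcounit, Fintype.sum_prod_type_right]
  · intro h
    have : TensorProduct.map ι.toLinearMap ι.toLinearMap ∘ₗ Coalgebra.comul (R := k) (A := H) =
        LinearMap.mulRight k (algSolution k s).inv ∘ₗ LinearMap.mulLeft k (algSolution k s).val ∘ₗ
          (TensorProduct.mk k _ _).flip 1 ∘ₗ ι.toLinearMap := by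
      refine b.ext fun i => ?_
      simp only [LinearMap.comp_apply, hcomul, M.pair.map_comulOn hb, LinearMap.mulRight_apply,
        LinearMap.mulLeft_apply, LinearMap.flip_apply, TensorProduct.mk_apply,
        AlgHom.toLinearMap_apply, hb]
      exact (Units.eq_mul_inv_iff_mul_eq (algSolution k s)).2 (M.comulOn_right_mul k i)
    exact LinearMap.congr_fun this h
  · intro h f hf
    rw [hval] at hf
    rw [eq_sum_of_map_eq hι hb hf, show (algSolution k s).inv = _ from M.tensorOf_symm_eq_sum k,
      sliceRight_sum]
    simp [hantipode, hb]

theorem exists_leftCoefficientHopfAlgebra :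
    ∃ (H : Type (max u v)) (_ : Ring H) (_ : HopfAlgebra k H) (ι : H →ₐ[k] Matrix S S k),
      IsLeftCoefficientHopfAlgebra s ι ∧ ∃ b : Module.Basis (A × G) k H,
        (∀ i, ι (b i) = M.left k i) ∧ StructureConstantsIn ({0, 1} : Set k) b ∧
        IsPhiSetTheoretic b := by
  have hli : LinearIndependent k (M.left k ∘ Prod.swap) :=
    (linearIndependent_of_coord _ (M.leftCoord_left k)).comp _ Prod.swap_injective
  obtain ⟨H, _, _, ι, b, hι, hb, hcounit, hcomul, hantipode, hsc, hphi⟩ :=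
    (M.left_isBicrossedBasis k).exists_hopfAlgebra hli
  have hval : ∀ f, sliceLeft (algSolution k s).val f = ∑ i, f (M.right k i) • M.left k i := by
    intro f
    rw [← sliceLeft_sum, ← M.tensorOf_eq_sum k]; rfl
  have hb' : ∀ i, ι (b.reindex (Equiv.prodComm G A) i) = M.left k i := by
    intro i
    simp [hb]
  refine ⟨H, _, _, ι, ⟨hι, ?_, ?_, ?_, ?_⟩, b.reindex (Equiv.prodComm G A), hb',
    hsc.reindex _, hphi.reindex _⟩
  · rw [range_eq_range_sum hb' (M.rightCoord k) (M.rightCoord_right k)]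
    exact congrArg Set.range (funext fun f => (hval f).symm)
  · intro h f hf
    rw [hval] at hf
    rw [eq_sum_of_map_eq hι hb' hf, ← (M.right_isBicrossedBasis k).one]
    simp [hcounit, Fintype.sum_prod_type]
  · intro h
    have : TensorProduct.map ι.toLinearMap ι.toLinearMap ∘ₗ Coalgebra.comul (R := k) (A := H) =
        LinearMap.mulRight k (algSolution k s).val ∘ₗ LinearMap.mulLeft k (algSolution k s).inv ∘ₗ
          TensorProduct.mk k _ _ 1 ∘ₗ ι.toLinearMap := by
      refine b.ext fun i => ?_
      simp only [LinearMap.comp_apply, hcomul, M.pair.swap.map_comulOn hb, LinearMap.mulRight_apply,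
        LinearMap.mulLeft_apply, TensorProduct.mk_apply, AlgHom.toLinearMap_apply, hb]
      rw [mul_assoc]
      exact (Units.eq_inv_mul_iff_mul_eq (algSolution k s)).2 (M.mul_comulOn_left k i)
    exact LinearMap.congr_fun this h
  · intro h f hf
    rw [hval] at hf
    rw [eq_sum_of_map_eq hι hb' hf, show (algSolution k s).inv = _ from M.tensorOf_symm_eq_sum' k,
      sliceLeft_sum]
    simp only [map_sum, map_smul, Module.Basis.reindex_apply, hantipode, hb]
    rfl

end HopfAlgebras

section Transversal

variable (M : MatchedSolution A G s)

theorem psi_apply (x y : S) : psi s y x = M.π y • x := congrArg Prod.fst (M.apply x y)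

theorem circ_apply (x y : S) : circ s y x = M.ρ x • y := congrArg Prod.snd (M.apply x y)

theorem psi_apply_eq_iff {x y z : S} : psi s y x = psi s z x ↔ M.π y = M.π z := by
  rw [M.psi_apply, M.psi_apply]
  exact ⟨M.smul_right_cancel', fun h => by rw [h]⟩

theorem circ_apply_eq_iff {x y z : S} : circ s z x = circ s z y ↔ M.ρ x = M.ρ y := by
  rw [M.circ_apply, M.circ_apply]
  exact ⟨M.smul_right_cancel, fun h => by rw [h]⟩

theorem psi_eq_iff {y z : S} : psi s y = psi s z ↔ M.π y = M.π z :=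
  ⟨fun h => (M.psi_apply_eq_iff (x := y)).1 (congrFun h y),
    fun h => funext fun _ => M.psi_apply_eq_iff.2 h⟩

theorem isIdem_iff_ρ_eq_one {e : S} : IsIdem s e ↔ M.ρ e = 1 := by
  rw [IsIdem, M.circ_apply]
  exact ⟨fun h => M.smul_right_cancel (h.trans (one_smul G e).symm), fun h => by rw [h, one_smul]⟩

/-- The group `A` fixes `1 ∈ G`, so it preserves the idempotents, and moving one of them by `A`
reaches every value of `π`. -/
theorem exists_idempotent_π_eq (a : A) : ∃ e, M.ρ e = 1 ∧ M.π e = a := by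
  obtain ⟨e, he⟩ := M.ρ_surjective 1
  refine ⟨(a⁻¹ * M.π e) • e, ?_, ?_⟩
  · rw [M.ρ_smul, he]
    exact M.pair.actG_one _
  · rw [M.π_smul', he, ← M.pair_actA, M.pair.one_actA]
    group

theorem exists_isTransversal (M : MatchedSolution A G s) :
    ∃ (one : S) (Ebar : Set S), IsTransversal s one Ebar := by
  classical
  choose sec hsec hsec' using M.exists_idempotent_π_eq
  refine ⟨sec 1, Set.range sec, M.isIdem_iff_ρ_eq_one.2 (hsec 1), ?_, ⟨1, rfl⟩, ?_, ?_⟩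
  · funext x
    rw [M.psi_apply, hsec', one_smul, id]
  · rintro _ ⟨a, rfl⟩
    exact M.isIdem_iff_ρ_eq_one.2 (hsec a)
  · intro e _
    refine ⟨sec (M.π e), ⟨⟨_, rfl⟩, M.psi_eq_iff.2 (hsec' _)⟩, ?_⟩
    rintro _ ⟨⟨a, rfl⟩, h⟩
    rw [← M.psi_eq_iff.1 h, hsec']

/-- The index set of the bases in terms of the two groups. -/
noncomputable def indexEquiv {one : S} {Ebar : Set S} (h : IsTransversal s one Ebar) :
    Ebar × groupPart s one ≃ A × G :=
  Equiv.prodCongr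
    (Equiv.ofBijective (fun e : Ebar => M.π e) (by
      constructor
      · intro e f hef
        exact Subtype.ext ((h.existsUnique f (h.isIdem_of_mem f f.2)).unique
          ⟨e.2, M.psi_eq_iff.2 hef⟩ ⟨f.2, rfl⟩)
      · intro a
        obtain ⟨e, he, rfl⟩ := M.exists_idempotent_π_eq a
        obtain ⟨f, ⟨hf, hfe⟩, -⟩ := h.existsUnique e (M.isIdem_iff_ρ_eq_one.2 he)
        exact ⟨⟨f, hf⟩, M.psi_eq_iff.1 hfe⟩))
    (Equiv.ofBijective (fun g : groupPart s one => M.ρ g) (by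
      have hone : M.ρ one = 1 := M.isIdem_iff_ρ_eq_one.1 h.isIdem_one
      have hρ : ∀ x, M.ρ (circ s one x) = M.ρ x := fun x => by
        rw [M.circ_apply, M.ρ_smul', hone, mul_one]
      constructor
      · rintro ⟨_, x, rfl⟩ ⟨_, y, rfl⟩ hxy
        simp only [hρ] at hxy
        exact Subtype.ext (M.circ_apply_eq_iff.2 hxy)
      · intro σ
        obtain ⟨x, rfl⟩ := M.ρ_surjective σ
        exact ⟨⟨_, x, rfl⟩, hρ x⟩))

theorem indexEquiv_apply {one : S} {Ebar : Set S} (h : IsTransversal s one Ebar) (e : Ebar)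
    (g : groupPart s one) : M.indexEquiv h (e, g) = (M.π e, M.ρ g) := rfl

theorem right_eq_rightBasisElement [Fintype S] [DecidableEq S] [DecidableEq A] (y' x' : S) :
    M.right k (M.π y', M.ρ x') = rightBasisElement k s y' x' :=
  partialMatrix_congr k (fun _ => M.psi_eq_iff.symm) fun y _ => (M.circ_apply x' y).symm

/-- As `A` acts freely, `ψ_y` and `ψ_{y'}` coincide once they agree at `x'`, so the two index sets
of the sums are equal. -/
theorem right_mem_rightSpanningSet [Fintype S] [DecidableEq S] [DecidableEq A] (y' x' : S) :
    M.right k (M.π y', M.ρ x') ∈ rightSpanningSet k s :=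
  ⟨x', y', partialMatrix_congr k (fun _ => M.psi_apply_eq_iff.symm)
    fun y _ => (M.circ_apply x' y).symm⟩

theorem left_eq_leftBasisElement [Fintype S] [DecidableEq S] [DecidableEq G] (y' x' : S) :
    M.left k (M.π y', M.ρ x') = leftBasisElement k s y' x' := by
  classical
  refine partialMatrix_congr k (fun x => ?_) fun x _ => (M.psi_apply x y').symm
  constructor
  · intro h
    -- The witness is the idempotent `e` with `e ∘ x = x`; since `ρ x = ρ x'`, also `e ∘ x' = x`.
    refine ⟨(M.ρ x)⁻¹ • x, ?_, ?_⟩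
    · rw [M.isIdem_iff_ρ_eq_one, M.ρ_smul', inv_mul_cancel]
    · rw [M.circ_apply, ← show M.ρ x = M.ρ x' from h, smul_inv_smul]
  · rintro ⟨e, he, rfl⟩
    rw [M.circ_apply, M.ρ_smul', M.isIdem_iff_ρ_eq_one.1 he, mul_one]

theorem left_mem_leftSpanningSet [Fintype S] [DecidableEq S] [DecidableEq G] (y' x' : S) :
    M.left k (M.π y', M.ρ x') ∈ leftSpanningSet k s :=
  ⟨x', y', partialMatrix_congr k (fun _ => M.circ_apply_eq_iff.symm)
    fun x _ => (M.psi_apply x y').symm⟩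

end Transversal

end MatchedSolution

end PentagonHopf

theorem theorem5p2 {k : Type v} [Field k] [CharZero k]
    {S : Type u} [Fintype S] [DecidableEq S] [Nonempty S]
    (s : Equiv.Perm (S × S)) (hs : PentagonHopf.IsRPESolution s) :
    -- the data indexing the bases exist
    (∃ (one : S) (Ebar : Set S), PentagonHopf.IsTransversal s one Ebar) ∧
    -- the right coefficient Hopf algebra
    (∃ (H : Type (max u v)) (_ : Ring H) (_ : HopfAlgebra k H) (ι : H →ₐ[k] Matrix S S k),
      PentagonHopf.IsRightCoefficientHopfAlgebra s ι ∧
      ∀ (one : S) (Ebar : Set S), PentagonHopf.IsTransversal s one Ebar →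
        ∃ b : Module.Basis (Ebar × PentagonHopf.groupPart s one) k H,
          (∀ (y' : Ebar) (x' : PentagonHopf.groupPart s one),
            ι (b (y', x')) = PentagonHopf.rightBasisElement k s y' x') ∧
          (∀ i, ι (b i) ∈ PentagonHopf.rightSpanningSet k s) ∧
          (∀ σ : k →+* ℂ, PentagonHopf.IsPositiveBasis σ b) ∧
          PentagonHopf.StructureConstantsIn ({0, 1} : Set k) b ∧
          PentagonHopf.IsPhiSetTheoretic b) ∧
    -- the left coefficient Hopf algebra
    (∃ (H : Type (max u v)) (_ : Ring H) (_ : HopfAlgebra k H) (ι : H →ₐ[k] Matrix S S k),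
      PentagonHopf.IsLeftCoefficientHopfAlgebra s ι ∧
      ∀ (one : S) (Ebar : Set S), PentagonHopf.IsTransversal s one Ebar →
        ∃ b : Module.Basis (Ebar × PentagonHopf.groupPart s one) k H,
          (∀ (y' : Ebar) (x' : PentagonHopf.groupPart s one),
            ι (b (y', x')) = PentagonHopf.leftBasisElement k s y' x') ∧
          (∀ i, ι (b i) ∈ PentagonHopf.leftSpanningSet k s) ∧
          (∀ σ : k →+* ℂ, PentagonHopf.IsPositiveBasis σ b) ∧
          PentagonHopf.StructureConstantsIn ({0, 1} : Set k) b ∧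
          PentagonHopf.IsPhiSetTheoretic b) := by
  classical
  obtain ⟨M⟩ := PentagonHopf.nonempty_matchedSolution hs
  let _ := Fintype.ofFinite (PentagonHopf.psiGroup hs)
  let _ := Fintype.ofFinite (PentagonHopf.rhoGroup hs)
  refine ⟨M.exists_isTransversal, ?_, ?_⟩
  · obtain ⟨H, _, _, ι, hH, b, hb, hsc, hphi⟩ := M.exists_rightCoefficientHopfAlgebra k
    refine ⟨H, _, _, ι, hH, fun one Ebar h => ?_⟩
    have hb' : ∀ y' x', ι (b.reindex (M.indexEquiv h).symm (y', x')) =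
        M.right k (M.π y', M.ρ x') := by
      intro y' x'
      rw [Module.Basis.reindex_apply, Equiv.symm_symm, M.indexEquiv_apply, hb]
    refine ⟨b.reindex (M.indexEquiv h).symm, fun y' x' => ?_, fun ⟨y', x'⟩ => ?_,
      (hsc.reindex _).isPositiveBasis, hsc.reindex _, hphi.reindex _⟩
    · rw [hb', M.right_eq_rightBasisElement k]
    · rw [hb']
      exact M.right_mem_rightSpanningSet k y' x'
  · obtain ⟨H, _, _, ι, hH, b, hb, hsc, hphi⟩ := M.exists_leftCoefficientHopfAlgebra k
    refine ⟨H, _, _, ι, hH, fun one Ebar h => ?_⟩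
    have hb' : ∀ y' x', ι (b.reindex (M.indexEquiv h).symm (y', x')) =
        M.left k (M.π y', M.ρ x') := by
      intro y' x'
      rw [Module.Basis.reindex_apply, Equiv.symm_symm, M.indexEquiv_apply, hb]
    refine ⟨b.reindex (M.indexEquiv h).symm, fun y' x' => ?_, fun ⟨y', x'⟩ => ?_,
      (hsc.reindex _).isPositiveBasis, hsc.reindex _, hphi.reindex _⟩
    · rw [hb', M.left_eq_leftBasisElement k]
    · rw [hb']
      exact M.left_mem_leftSpanningSet k y' x'
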